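/- **Setting.** Let $\alpha,\tau>1$ and let $Z$ be a metric space with $\operatorname{diam} Z<1$. Fix $z_0\in Z$, put $A_0=\{z_0\}$, and for each $n\ge1$ let $A_n\subset Z$ be a maximal $\alpha^{-n}$-separated set (distinct points have distance at least $\alpha^{-n}$), chosen so that $A_n\subset A_m$ whenever $m\ge n\ge0$. Let $V=\{(x,n): n\ge 0,\ x\in A_n\}$. Two different vertices $(x,n),(y,m)\in V$ are neighbors if either $n=m$ and $B_Z(x,\tau\alpha^{-n})\cap B_Z(y,\tau\alpha^{-m})\neq\emptyset$, or $|n-m|=1$ and $B_Z(x,\alpha^{-n})\cap B_Z(y,\alpha^{-m})\ne\emptyset$ (open balls). The metric graph $X$ with vertex set $V$, these edges (each a unit interval), and the path metric $d_X$ is called a *hyperbolic filling* of $Z$ with parameters $\alpha,\tau$; its root is $v_0=(z_0,0)$. For $x,y\in X$ let $$(x|y)_{v_0}=\tfrac12\bigl[d_X(v_0,x)+d_X(v_0,y)-d_X(x,y)\bigr],\qquad d_\varepsilon(x,y)=\inf_\gamma\int_\gamma e^{-\varepsilon d_X(\cdot,v_0)}\,ds,$$ where the infimum is over all rectifiable curves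 $\gamma$ in $X$ from $x$ to $y$, and $ds$ is arc length with respect to $d_X$. The *uniformization* $X_\varepsilon$ is the set $X$ equipped with the metric $d_\varepsilon$. A nonempty open proper subset $\Omega$ of a metric space $(Y,d)$ is an *$A$-uniform domain*, $A\ge1$, if any $x,y\in\Omega$ can be joined by a rectifiable arc length parametrized curve $\gamma:[0,\ell]\to\Omega$ with $\gamma(0)=x$, $\gamma(\ell)=y$, $\ell\le A\,d(x,y)$ and $\operatorname{dist}(\gamma(t),Y\setminus\Omega)\ge\frac1A\min\{t,\ell-t\}$ for $0\le t\le\ell$. A noncomplete metric space is *$A$-uniform* if it is an $A$-uniform domain in its completion. **Theorem.** Let $\alpha,\tau>1$ and $0<\varepsilon\le\log\alpha$. There are constants $A,C\ge1$, depending only on $\alpha$, $\tau$ and $\varepsilon$, such that for every metric space $Z$ with $\operatorname{diam}Z<1$ and every hyperbolic filling $X$ of $Z$ with parameters $\alpha,\tau$, the space $X_\varepsilon$ is (noncomplete and) $A$-uniform, and for all $x',x''\in X$, $$\frac1C\,e^{-\varepsilon(x'|x'')_{v_0}}\min\{d_X(x',x''),1\}\le d_\varepsilon(x',x'')\le C\,e^{-\varepsilon(x'|x'')_{v_0}}\min\{d_X(x',x''),1\}.$$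 -/

import Mathlib

namespace HypFill

/-! ### Curves parametrized by arc length -/

/-- `γ` restricted to `[0, L]` is a rectifiable curve from `x` to `y` of length `L`,
parametrized by arc length. (Such a curve is automatically continuous on `[0, L]`.) -/
structure IsArcLengthCurve {X : Type*} [PseudoMetricSpace X] (γ : ℝ → X) (L : ℝ) (x y : X) :
    Prop where
  nonneg : 0 ≤ L
  unit_speed : HasUnitSpeedOn γ (Set.Icc 0 L)
  source : γ 0 = x
  target : γ L = y

section Curves

variable {X : Type*} [PseudoMetricSpace X]

theorem IsArcLengthCurve.refl (x : X) : IsArcLengthCurve (fun _ => x) 0 x x where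
  nonneg := le_rfl
  unit_speed := by
    apply hasConstantSpeedOnWith_of_subsingleton
    simp
  source := rfl
  target := rfl

theorem IsArcLengthCurve.dist_le {γ : ℝ → X} {L : ℝ} {x y : X} (h : IsArcLengthCurve γ L x y)
    {a b : ℝ} (ha : a ∈ Set.Icc 0 L) (hb : b ∈ Set.Icc 0 L) : dist (γ a) (γ b) ≤ |a - b| := by
  wlog hab : a ≤ b generalizing a b
  · rw [dist_comm, abs_sub_comm]
    exact this hb ha (le_of_not_ge hab)
  have h1 := h.unit_speed ha hb
  have h2 : edist (γ a) (γ b) ≤ eVariationOn γ (Set.Icc 0 L ∩ Set.Icc a b) :=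
    eVariationOn.edist_le γ ⟨ha, le_rfl, hab⟩ ⟨hb, hab, le_rfl⟩
  rw [h1, edist_dist] at h2
  have h3 : 0 ≤ b - a := sub_nonneg.2 hab
  rw [ENNReal.ofReal_le_ofReal_iff (by simpa using h3)] at h2
  rw [abs_sub_comm, abs_of_nonneg h3]
  simpa using h2

theorem IsArcLengthCurve.continuousOn {γ : ℝ → X} {L : ℝ} {x y : X}
    (h : IsArcLengthCurve γ L x y) : ContinuousOn γ (Set.Icc 0 L) := by
  have : LipschitzOnWith 1 γ (Set.Icc 0 L) := by
    apply LipschitzOnWith.of_dist_le_mul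
    intro a ha b hb
    simpa [Real.dist_eq] using h.dist_le ha hb
  exact this.continuousOn

theorem IsArcLengthCurve.of_isometry {γ : ℝ → X} {L : ℝ} (hL : 0 ≤ L)
    (h : ∀ a ∈ Set.Icc 0 L, ∀ b ∈ Set.Icc 0 L, dist (γ a) (γ b) = |a - b|) :
    IsArcLengthCurve γ L (γ 0) (γ L) where
  nonneg := hL
  unit_speed := by
    refine hasConstantSpeedOnWith_iff_ordered.2 fun a ha b hb hab => ?_
    have e : ∀ u ∈ Set.Icc 0 L, ∀ v ∈ Set.Icc 0 L, edist (γ u) (γ v) = edist u v := by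
      intro u hu v hv
      rw [edist_dist, edist_dist, h u hu v hv, Real.dist_eq]
    apply le_antisymm
    · refine iSup_le ?_
      rintro ⟨n, u, hu, us⟩
      have h1 : ∀ i, edist (γ (u (i + 1))) (γ (u i)) = edist (id (u (i + 1))) (id (u i)) :=
        fun i => e _ (us _).1 _ (us _).1
      simp only [h1]
      refine (eVariationOn.sum_le (f := id) hu us).trans ?_
      have h2 := (monotone_id.monotoneOn (Set.Icc 0 L)).eVariationOn_eq ha hb
      rw [h2]
      simp
    · have h1 : edist (γ a) (γ b) ≤ eVariationOn γ (Set.Icc 0 L ∩ Set.Icc a b) :=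
        eVariationOn.edist_le γ ⟨ha, le_rfl, hab⟩ ⟨hb, hab, le_rfl⟩
      rw [e a ha b hb, edist_dist, Real.dist_eq, abs_sub_comm,
        abs_of_nonneg (sub_nonneg.2 hab)] at h1
      simpa using h1
  source := rfl
  target := rfl

theorem IsArcLengthCurve.symm {γ : ℝ → X} {L : ℝ} {x y : X} (h : IsArcLengthCurve γ L x y) :
    IsArcLengthCurve (fun t => γ (L - t)) L y x where
  nonneg := h.nonneg
  unit_speed := by
    refine hasConstantSpeedOnWith_iff_ordered.2 fun a ha b hb hab => ?_
    have hanti : AntitoneOn (fun t : ℝ => L - t) (Set.Icc 0 L ∩ Set.Icc a b) := by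
      intro u _ v _ huv
      exact sub_le_sub_left huv L
    have h1 := eVariationOn.comp_eq_of_antitoneOn γ (fun t : ℝ => L - t) hanti
    have h2 : (fun t : ℝ => L - t) '' (Set.Icc 0 L ∩ Set.Icc a b)
        = Set.Icc 0 L ∩ Set.Icc (L - b) (L - a) := by
      rw [Set.image_inter (sub_right_injective), Set.image_const_sub_Icc,
        Set.image_const_sub_Icc]
      simp
    have mb : L - b ∈ Set.Icc 0 L := ⟨by linarith [hb.2], by linarith [hb.1]⟩
    have ma : L - a ∈ Set.Icc 0 L := ⟨by linarith [ha.2], by linarith [ha.1]⟩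
    have h3 := h.unit_speed mb ma
    have h4 : eVariationOn (fun t => γ (L - t)) (Set.Icc 0 L ∩ Set.Icc a b)
      = eVariationOn γ ((fun t : ℝ => L - t) '' (Set.Icc 0 L ∩ Set.Icc a b)) := h1
    rw [h4, h2, h3]
    congr 2
    ring
  source := by simpa using h.target
  target := by simpa using h.source

theorem IsArcLengthCurve.trans {γ₁ γ₂ : ℝ → X} {L₁ L₂ : ℝ} {x y z : X}
    (h₁ : IsArcLengthCurve γ₁ L₁ x y) (h₂ : IsArcLengthCurve γ₂ L₂ y z) :
    IsArcLengthCurve (fun t => if t ≤ L₁ then γ₁ t else γ₂ (t - L₁)) (L₁ + L₂) x z where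
  nonneg := add_nonneg h₁.nonneg h₂.nonneg
  unit_speed := by
    set γ : ℝ → X := fun t => if t ≤ L₁ then γ₁ t else γ₂ (t - L₁) with hγ
    have e₁ : ∀ t, t ≤ L₁ → γ t = γ₁ t := fun t ht => by simp [hγ, ht]
    have e₂ : ∀ t, L₁ ≤ t → γ t = γ₂ (t - L₁) := by
      intro t ht
      rcases ht.eq_or_lt with rfl | ht
      · rw [e₁ _ le_rfl, h₁.target, sub_self, h₂.source]
      · simp [hγ, not_le.2 ht]
    have s₁ : HasUnitSpeedOn γ (Set.Icc 0 L₁) := by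
      intro a ha b hb
      rw [← h₁.unit_speed ha hb]
      exact eVariationOn.congr fun t ht => e₁ t ht.1.2
    have s₂ : HasUnitSpeedOn γ (Set.Icc L₁ (L₁ + L₂)) := by
      intro a ha b hb
      have hmono : MonotoneOn (fun t : ℝ => t - L₁) (Set.Icc L₁ (L₁ + L₂) ∩ Set.Icc a b) := by
        intro u _ v _ huv
        simpa using huv
      have k1 := eVariationOn.comp_eq_of_monotoneOn γ₂ (fun t : ℝ => t - L₁) hmono
      have k2 : (fun t : ℝ => t - L₁) '' (Set.Icc L₁ (L₁ + L₂) ∩ Set.Icc a b)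
          = Set.Icc 0 L₂ ∩ Set.Icc (a - L₁) (b - L₁) := by
        rw [Set.image_inter (sub_left_injective), Set.image_sub_const_Icc,
          Set.image_sub_const_Icc]
        simp
      have ma : a - L₁ ∈ Set.Icc 0 L₂ := ⟨by linarith [ha.1], by linarith [ha.2]⟩
      have mb : b - L₁ ∈ Set.Icc 0 L₂ := ⟨by linarith [hb.1], by linarith [hb.2]⟩
      have k3 := h₂.unit_speed ma mb
      have k4 : eVariationOn γ (Set.Icc L₁ (L₁ + L₂) ∩ Set.Icc a b)
          = eVariationOn (γ₂ ∘ fun t : ℝ => t - L₁) (Set.Icc L₁ (L₁ + L₂) ∩ Set.Icc a b) :=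
        eVariationOn.congr fun t ht => e₂ t ht.1.1
      rw [k4, k1, k2, k3]
      congr 2
      ring
    exact s₁.Icc_Icc s₂
  source := by simp [h₁.nonneg, h₁.source]
  target := by
    rcases h₂.nonneg.eq_or_lt with h | h
    · subst h
      simp [h₁.target, ← h₂.source, h₂.target]
    · have : ¬ (L₁ + L₂ ≤ L₁) := by linarith
      simp [this, h₂.target]

end Curves

/-! ### Uniform domains and uniform spaces -/

/-- `Ω` is an `A`-uniform domain in `Y`: a nonempty open proper subset in which any two points
are joined by an `A`-uniform curve. -/
structure IsUniformDomain {Y : Type*} [MetricSpace Y] (A : ℝ) (Ω : Set Y) : Prop where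
  one_le : 1 ≤ A
  nonempty : Ω.Nonempty
  isOpen : IsOpen Ω
  ne_univ : Ω ≠ Set.univ
  exists_curve : ∀ x ∈ Ω, ∀ y ∈ Ω, ∃ (L : ℝ) (γ : ℝ → Y),
    IsArcLengthCurve γ L x y ∧ (∀ t ∈ Set.Icc 0 L, γ t ∈ Ω) ∧
    L ≤ A * dist x y ∧
    ∀ t ∈ Set.Icc 0 L, 1 / A * min t (L - t) ≤ Metric.infDist (γ t) Ωᶜ

/-- A noncomplete metric space is `A`-uniform if it is an `A`-uniform domain in its
completion. -/
structure IsUniformMetricSpace (A : ℝ) (Ω : Type*) [MetricSpace Ω] : Prop where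
  not_complete : ¬ CompleteSpace Ω
  isUniformDomain : IsUniformDomain A
    (Set.range ((↑) : Ω → UniformSpace.Completion Ω))

/-! ### The uniformization of a metric space -/

/-- Any two points are joined by a rectifiable curve. -/
class RectifiablyConnected (X : Type*) [PseudoMetricSpace X] : Prop where
  exists_curve : ∀ x y : X, ∃ (L : ℝ) (γ : ℝ → X), IsArcLengthCurve γ L x y

/-- The length `∫_γ ρ_ε ds` of an arc length parametrized curve `γ : [0, L] → X` with respect to
the density `ρ_ε(x) = exp (-ε d(x, x₀))`. -/
noncomputable def weightedLength {X : Type*} [PseudoMetricSpace X] (ε : ℝ) (x₀ : X)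
    (γ : ℝ → X) (L : ℝ) : ℝ :=
  ∫ t in (0 : ℝ)..L, Real.exp (-ε * dist (γ t) x₀)

/-- The uniformized metric `d_ε(x, y) = inf_γ ∫_γ ρ_ε ds`, the infimum being over all
rectifiable curves from `x` to `y`. -/
noncomputable def uniformizedDist {X : Type*} [PseudoMetricSpace X] (ε : ℝ) (x₀ x y : X) : ℝ :=
  sInf {r | ∃ (L : ℝ) (γ : ℝ → X), IsArcLengthCurve γ L x y ∧ r = weightedLength ε x₀ γ L}

section UniformizedDist

variable {X : Type*} [PseudoMetricSpace X] {ε : ℝ} {x₀ x y z : X}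

theorem weightedLength_nonneg {γ : ℝ → X} {L : ℝ} (hL : 0 ≤ L) :
    0 ≤ weightedLength ε x₀ γ L :=
  intervalIntegral.integral_nonneg hL fun _ _ => (Real.exp_pos _).le

theorem uniformizedDist_bddBelow : BddBelow
    {r | ∃ (L : ℝ) (γ : ℝ → X), IsArcLengthCurve γ L x y ∧ r = weightedLength ε x₀ γ L} := by
  refine ⟨0, ?_⟩
  rintro r ⟨L, γ, h, rfl⟩
  exact weightedLength_nonneg h.nonneg

theorem uniformizedDist_le {γ : ℝ → X} {L : ℝ} (h : IsArcLengthCurve γ L x y) :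
    uniformizedDist ε x₀ x y ≤ weightedLength ε x₀ γ L :=
  csInf_le uniformizedDist_bddBelow ⟨L, γ, h, rfl⟩

theorem le_uniformizedDist [RectifiablyConnected X] {c : ℝ}
    (h : ∀ (L : ℝ) (γ : ℝ → X), IsArcLengthCurve γ L x y → c ≤ weightedLength ε x₀ γ L) :
    c ≤ uniformizedDist ε x₀ x y := by
  obtain ⟨L, γ, hγ⟩ := RectifiablyConnected.exists_curve x y
  refine le_csInf ⟨_, L, γ, hγ, rfl⟩ ?_
  rintro r ⟨L, γ, hγ, rfl⟩
  exact h L γ hγ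

theorem weightedLength_integrand_continuousOn {γ : ℝ → X} {L : ℝ}
    (h : IsArcLengthCurve γ L x y) :
    ContinuousOn (fun t => Real.exp (-ε * dist (γ t) x₀)) (Set.Icc 0 L) := by
  have := h.continuousOn
  fun_prop

theorem weightedLength_symm (γ : ℝ → X) (L : ℝ) :
    weightedLength ε x₀ (fun t => γ (L - t)) L = weightedLength ε x₀ γ L := by
  unfold weightedLength
  rw [intervalIntegral.integral_comp_sub_left (fun t => Real.exp (-ε * dist (γ t) x₀))]
  simp

theorem weightedLength_trans {γ₁ γ₂ : ℝ → X} {L₁ L₂ : ℝ}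
    (h₁ : IsArcLengthCurve γ₁ L₁ x y) (h₂ : IsArcLengthCurve γ₂ L₂ y z) :
    weightedLength ε x₀ (fun t => if t ≤ L₁ then γ₁ t else γ₂ (t - L₁)) (L₁ + L₂)
      = weightedLength ε x₀ γ₁ L₁ + weightedLength ε x₀ γ₂ L₂ := by
  have h := h₁.trans h₂
  have c := weightedLength_integrand_continuousOn (ε := ε) (x₀ := x₀) h
  unfold weightedLength
  have l1 : L₁ ≤ L₁ + L₂ := by linarith [h₂.nonneg]
  rw [← intervalIntegral.integral_add_adjacent_intervals (b := L₁)]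
  · congr 1
    · refine intervalIntegral.integral_congr fun t ht => ?_
      rw [Set.uIcc_of_le h₁.nonneg] at ht
      simp [ht.2]
    · have e : ∫ t in L₁..(L₁ + L₂),
          Real.exp (-ε * dist (if t ≤ L₁ then γ₁ t else γ₂ (t - L₁)) x₀)
          = ∫ t in L₁..(L₁ + L₂), Real.exp (-ε * dist (γ₂ (t - L₁)) x₀) := by
        refine intervalIntegral.integral_congr fun t ht => ?_
        rw [Set.uIcc_of_le l1] at ht
        rcases ht.1.eq_or_lt with h' | h'
        · subst h'
          simp [h₁.target, h₂.source]
        · simp [not_le.2 h']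
      rw [e, intervalIntegral.integral_comp_sub_right
        (fun t => Real.exp (-ε * dist (γ₂ t) x₀))]
      simp
  · refine (c.mono ?_).intervalIntegrable
    rw [Set.uIcc_of_le h₁.nonneg]
    exact Set.Icc_subset_Icc le_rfl l1
  · refine (c.mono ?_).intervalIntegrable
    rw [Set.uIcc_of_le l1]
    exact Set.Icc_subset_Icc h₁.nonneg le_rfl

theorem uniformizedDist_self (x : X) : uniformizedDist ε x₀ x x = 0 := by
  apply le_antisymm
  · refine (uniformizedDist_le (IsArcLengthCurve.refl x)).trans ?_
    simp [weightedLength]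
  · apply Real.sInf_nonneg
    rintro r ⟨L, γ, h, rfl⟩
    exact weightedLength_nonneg h.nonneg

theorem uniformizedDist_comm [RectifiablyConnected X] (x y : X) :
    uniformizedDist ε x₀ x y = uniformizedDist ε x₀ y x := by
  have key : ∀ a b : X, uniformizedDist ε x₀ a b ≤ uniformizedDist ε x₀ b a := by
    intro a b
    refine le_uniformizedDist fun L γ h => ?_
    rw [← weightedLength_symm]
    exact uniformizedDist_le h.symm
  exact le_antisymm (key x y) (key y x)

theorem uniformizedDist_triangle [RectifiablyConnected X] (x y z : X) :
    uniformizedDist ε x₀ x z ≤ uniformizedDist ε x₀ x y + uniformizedDist ε x₀ y z := by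
  rw [← sub_le_iff_le_add]
  refine le_uniformizedDist fun L₁ γ₁ h₁ => ?_
  rw [sub_le_iff_le_add, ← sub_le_iff_le_add']
  refine le_uniformizedDist fun L₂ γ₂ h₂ => ?_
  rw [sub_le_iff_le_add', ← weightedLength_trans h₁ h₂]
  exact uniformizedDist_le (h₁.trans h₂)

theorem dist_eq_zero_of_uniformizedDist_eq_zero [RectifiablyConnected X] (x y : X)
    (h : uniformizedDist ε x₀ x y = 0) : dist x y = 0 := by
  by_contra hne
  have hd : 0 < dist x y := lt_of_le_of_ne dist_nonneg (Ne.symm hne)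
  set D := dist x y with hD
  have hc : 0 < D * Real.exp (-|ε| * (dist x x₀ + D)) := mul_pos hd (Real.exp_pos _)
  suffices D * Real.exp (-|ε| * (dist x x₀ + D)) ≤ uniformizedDist ε x₀ x y by linarith
  refine le_uniformizedDist fun L γ hγ => ?_
  have hDL : D ≤ L := by
    have := hγ.dist_le (a := 0) (b := L) ⟨le_rfl, hγ.nonneg⟩ ⟨hγ.nonneg, le_rfl⟩
    rw [hγ.source, hγ.target] at this
    simpa [abs_of_nonneg hγ.nonneg] using this
  have c := weightedLength_integrand_continuousOn (ε := ε) (x₀ := x₀) hγ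
  have i1 : IntervalIntegrable (fun t => Real.exp (-ε * dist (γ t) x₀)) MeasureTheory.volume 0 L :=
    (c.mono (by rw [Set.uIcc_of_le hγ.nonneg])).intervalIntegrable
  have i2 : IntervalIntegrable (fun t => Real.exp (-ε * dist (γ t) x₀)) MeasureTheory.volume 0 D :=
    (c.mono (by
      rw [Set.uIcc_of_le hd.le]
      exact Set.Icc_subset_Icc le_rfl hDL)).intervalIntegrable
  have h1 : ∫ t in (0 : ℝ)..D, Real.exp (-ε * dist (γ t) x₀) ≤ weightedLength ε x₀ γ L := by
    refine intervalIntegral.integral_mono_interval le_rfl hd.le hDL ?_ i1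
    exact Filter.Eventually.of_forall fun t => (Real.exp_pos _).le
  refine le_trans ?_ h1
  have h2 : ∫ _ in (0 : ℝ)..D, Real.exp (-|ε| * (dist x x₀ + D))
      ≤ ∫ t in (0 : ℝ)..D, Real.exp (-ε * dist (γ t) x₀) := by
    refine intervalIntegral.integral_mono_on hd.le (by simp) i2 fun t ht => ?_
    rw [Real.exp_le_exp]
    have h3 : dist (γ t) x₀ ≤ dist x x₀ + D := by
      have h4 := hγ.dist_le (a := t) (b := 0) ⟨ht.1, ht.2.trans hDL⟩ ⟨le_rfl, hγ.nonneg⟩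
      rw [hγ.source, sub_zero, abs_of_nonneg ht.1] at h4
      linarith [dist_triangle (γ t) x x₀, ht.2]
    have h5 : ε * dist (γ t) x₀ ≤ |ε| * (dist x x₀ + D) :=
      mul_le_mul (le_abs_self ε) h3 dist_nonneg (abs_nonneg ε)
    linarith
  simpa using h2

end UniformizedDist

/-- The set `X`, to be equipped with the uniformized metric `d_ε` with center `x₀`. -/
def Uniformization (X : Type*) (_x₀ : X) (_ε : ℝ) : Type _ := X

noncomputable instance {X : Type*} [PseudoMetricSpace X] (x₀ : X) (ε : ℝ) :
    Dist (Uniformization X x₀ ε) where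
  dist x y := uniformizedDist (X := X) ε x₀ x y

noncomputable instance {X : Type*} [MetricSpace X] [RectifiablyConnected X] (x₀ : X) (ε : ℝ) :
    MetricSpace (Uniformization X x₀ ε) where
  dist_self x := uniformizedDist_self (X := X) x
  dist_comm x y := uniformizedDist_comm (X := X) x y
  dist_triangle x y z := uniformizedDist_triangle (X := X) x y z
  eq_of_dist_eq_zero {x y} h :=
    (dist_eq_zero (γ := X)).1 (dist_eq_zero_of_uniformizedDist_eq_zero (X := X) x y h)

/-! ### Metric graphs with unit edges -/

/-- The point at distance `t ∈ [0, 1]` from `v` on the edge from `v` to `w`, in barycentric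
coordinates. -/
noncomputable def edgePoint {V : Type*} (v w : V) (t : ℝ) : V →₀ ℝ :=
  Finsupp.single v (1 - t) + Finsupp.single w t

/-- The underlying set of the metric graph of `G`: the union of the vertices (the case `v = w`)
and of the closed edges, described by barycentric coordinates. -/
def MetricGraph {V : Type*} (G : SimpleGraph V) : Type _ :=
  {p : V →₀ ℝ // ∃ v w : V, (v = w ∨ G.Adj v w) ∧ ∃ t ∈ Set.Icc (0 : ℝ) 1, p = edgePoint v w t}

namespace MetricGraph

variable {V : Type*} {G : SimpleGraph V}

/-- A vertex as a point of the metric graph. -/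
noncomputable def vertex (G : SimpleGraph V) (v : V) : MetricGraph G :=
  ⟨Finsupp.single v 1, v, v, Or.inl rfl, 0, by simp, by simp [edgePoint]⟩

/-- The point with parameter `t` on the edge from `v` to `w`. -/
noncomputable def onEdge {v w : V} (h : G.Adj v w) (t : ℝ) (ht : t ∈ Set.Icc (0 : ℝ) 1) :
    MetricGraph G :=
  ⟨edgePoint v w t, v, w, Or.inr h, t, ht, rfl⟩

/-- `IsPathLength p q L`: there is a piecewise linear path of length `L` from `p` to `q`, that is,
a finite concatenation of linear pieces, each of them contained in one closed unit edge. -/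
inductive IsPathLength (G : SimpleGraph V) : MetricGraph G → MetricGraph G → ℝ → Prop
  | nil (p : MetricGraph G) : IsPathLength G p p 0
  | cons {v w : V} (h : G.Adj v w) {s t : ℝ} (hs : s ∈ Set.Icc (0 : ℝ) 1)
      (ht : t ∈ Set.Icc (0 : ℝ) 1) {r : MetricGraph G} {L : ℝ}
      (hL : IsPathLength G (onEdge h t ht) r L) :
      IsPathLength G (onEdge h s hs) r (|s - t| + L)

/-- The path metric of a metric graph with unit edges: the infimum of the lengths of
piecewise linear paths. -/
noncomputable instance : Dist (MetricGraph G) where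
  dist p q := sInf {L | IsPathLength G p q L}

theorem IsPathLength.trans {p q r : MetricGraph G} {L M : ℝ} (h : IsPathLength G p q L)
    (h' : IsPathLength G q r M) : IsPathLength G p r (L + M) := by
  induction h with
  | nil p => simpa using h'
  | cons h hs ht _ ih =>
    rw [add_assoc]
    exact .cons h hs ht (ih h')

theorem IsPathLength.edge {v w : V} (h : G.Adj v w) {s t : ℝ} (hs : s ∈ Set.Icc (0 : ℝ) 1)
    (ht : t ∈ Set.Icc (0 : ℝ) 1) : IsPathLength G (onEdge h s hs) (onEdge h t ht) |s - t| := by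
  simpa using IsPathLength.cons h hs ht (.nil _)

theorem IsPathLength.symm {p q : MetricGraph G} {L : ℝ} (h : IsPathLength G p q L) :
    IsPathLength G q p L := by
  induction h with
  | nil p => exact .nil p
  | cons h hs ht _ ih =>
    rw [add_comm, abs_sub_comm]
    exact ih.trans (.edge h ht hs)

theorem abs_edgePoint_sub_le {v w : V} (h : v ≠ w) (s t : ℝ) (u : V) :
    |edgePoint v w s u - edgePoint v w t u| ≤ |s - t| := by
  classical
  simp only [edgePoint, Finsupp.add_apply, Finsupp.single_apply]
  by_cases h1 : v = u
  · have h2 : w ≠ u := fun h2 => h (h1.trans h2.symm)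
    simp only [h1, h2, if_true, if_false, add_zero]
    rw [abs_sub_comm s t]
    apply le_of_eq
    congr 1
    ring
  · by_cases h2 : w = u
    · simp [h1, h2]
    · simp [h1, h2]

theorem IsPathLength.abs_sub_le {p q : MetricGraph G} {L : ℝ} (h : IsPathLength G p q L) (u : V) :
    |p.1 u - q.1 u| ≤ L := by
  induction h with
  | nil p => simp
  | cons h hs ht _ ih =>
    exact (_root_.abs_sub_le _ _ _).trans (add_le_add (abs_edgePoint_sub_le h.ne _ _ u) ih)

theorem IsPathLength.nonneg {p q : MetricGraph G} {L : ℝ} (h : IsPathLength G p q L) : 0 ≤ L := by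
  induction h with
  | nil p => exact le_rfl
  | cons h hs ht _ ih => positivity

theorem IsPathLength.dist_le {p q : MetricGraph G} {L : ℝ} (h : IsPathLength G p q L) :
    dist p q ≤ L :=
  csInf_le ⟨0, fun _ h => IsPathLength.nonneg h⟩ h

theorem onEdge_zero {v w : V} (h : G.Adj v w) :
    onEdge h 0 (by simp) = vertex G v := by
  apply Subtype.ext
  simp [onEdge, vertex, edgePoint]

theorem onEdge_one {v w : V} (h : G.Adj v w) :
    onEdge h 1 (by simp) = vertex G w := by
  apply Subtype.ext
  simp [onEdge, vertex, edgePoint]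

theorem exists_isPathLength_vertex (p : MetricGraph G) :
    ∃ (v : V) (L : ℝ), IsPathLength G p (vertex G v) L := by
  obtain ⟨p, v, w, h, t, ht, rfl⟩ := p
  rcases h with rfl | h
  · refine ⟨v, 0, ?_⟩
    have e : (⟨edgePoint v v t, v, v, Or.inl rfl, t, ht, rfl⟩ : MetricGraph G) = vertex G v := by
      apply Subtype.ext
      simp [vertex, edgePoint]
    rw [e]
    exact .nil _
  · refine ⟨v, |t - 0|, ?_⟩
    rw [← onEdge_zero h]
    exact .edge h ht _

theorem exists_isPathLength [hG : Fact G.Connected] (p q : MetricGraph G) :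
    ∃ L, IsPathLength G p q L := by
  obtain ⟨v, L, hL⟩ := exists_isPathLength_vertex p
  obtain ⟨w, M, hM⟩ := exists_isPathLength_vertex q
  have key : ∀ {a b : V}, G.Walk a b → ∃ K, IsPathLength G (vertex G a) (vertex G b) K := by
    intro a b W
    induction W with
    | nil => exact ⟨0, .nil _⟩
    | cons h _ ih =>
      obtain ⟨K, hK⟩ := ih
      refine ⟨|0 - 1| + K, ?_⟩
      rw [← onEdge_zero h]
      rw [← onEdge_one h] at hK
      exact .cons h _ _ hK
  obtain ⟨W⟩ := hG.out.preconnected v w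
  obtain ⟨K, hK⟩ := key W
  exact ⟨_, (hL.trans hK).trans hM.symm⟩

theorem le_dist [Fact G.Connected] {p q : MetricGraph G} {c : ℝ}
    (h : ∀ L, IsPathLength G p q L → c ≤ L) : c ≤ dist p q :=
  le_csInf (exists_isPathLength p q) h

noncomputable instance [Fact G.Connected] : MetricSpace (MetricGraph G) where
  dist_self p := le_antisymm (IsPathLength.nil p).dist_le
    (le_dist fun _ h => h.nonneg)
  dist_comm p q := le_antisymm (le_dist fun _ h => h.symm.dist_le)
    (le_dist fun _ h => h.symm.dist_le)
  dist_triangle p q r := by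
    rw [← sub_le_iff_le_add]
    refine le_dist fun L hL => ?_
    rw [sub_le_iff_le_add, ← sub_le_iff_le_add']
    refine le_dist fun M hM => ?_
    rw [sub_le_iff_le_add']
    exact (hL.trans hM).dist_le
  eq_of_dist_eq_zero {p q} h := by
    apply Subtype.ext
    ext u
    have h1 : |p.1 u - q.1 u| ≤ dist p q := le_dist fun _ h => h.abs_sub_le u
    have h2 : |p.1 u - q.1 u| ≤ 0 := h1.trans h.le
    exact sub_eq_zero.1 (abs_eq_zero.1 (le_antisymm h2 (abs_nonneg _)))

theorem dist_onEdge [Fact G.Connected] {v w : V} (h : G.Adj v w) {s t : ℝ}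
    (hs : s ∈ Set.Icc (0 : ℝ) 1) (ht : t ∈ Set.Icc (0 : ℝ) 1) :
    dist (onEdge h s hs) (onEdge h t ht) = |s - t| := by
  apply le_antisymm (IsPathLength.edge h hs ht).dist_le
  refine le_dist fun L hL => ?_
  have := hL.abs_sub_le w
  simpa [onEdge, edgePoint, Finsupp.single_apply, h.ne] using this

instance [Fact G.Connected] : RectifiablyConnected (MetricGraph G) where
  exists_curve p q := by
    obtain ⟨L, hL⟩ := exists_isPathLength p q
    induction hL with
    | nil p => exact ⟨0, _, IsArcLengthCurve.refl p⟩
    | @cons v w h s t hs ht r L _ ih =>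
      have edge : ∀ {s t : ℝ} (hs : s ∈ Set.Icc (0 : ℝ) 1) (ht : t ∈ Set.Icc (0 : ℝ) 1), s ≤ t →
          ∃ (L : ℝ) (γ : ℝ → MetricGraph G),
            IsArcLengthCurve γ L (onEdge h s hs) (onEdge h t ht) := by
        intro s t hs ht hst
        let γ : ℝ → MetricGraph G := fun a =>
          onEdge h (Set.projIcc 0 1 zero_le_one (s + a)) (Subtype.coe_prop _)
        have hγ : ∀ a (ha : s + a ∈ Set.Icc (0 : ℝ) 1), γ a = onEdge h (s + a) ha := by
          intro a ha
          apply Subtype.ext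
          simp [γ, onEdge, Set.projIcc_of_mem zero_le_one ha]
        have hmem : ∀ a ∈ Set.Icc 0 (t - s), s + a ∈ Set.Icc (0 : ℝ) 1 := fun a ha =>
          ⟨by linarith [ha.1, hs.1], by linarith [ha.2, ht.2]⟩
        have hc : IsArcLengthCurve γ (t - s) (γ 0) (γ (t - s)) := by
          refine IsArcLengthCurve.of_isometry (sub_nonneg.2 hst) fun a ha b hb => ?_
          rw [hγ a (hmem a ha), hγ b (hmem b hb), dist_onEdge]
          congr 1
          ring
        refine ⟨t - s, γ, ?_⟩
        have h0 : γ 0 = onEdge h s hs := by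
          rw [hγ 0 (by simpa using hs)]
          simp
        have h1 : γ (t - s) = onEdge h t ht := by
          rw [hγ (t - s) (by simpa using ht)]
          simp
        rwa [h0, h1] at hc
      obtain ⟨M, γ₂, h₂⟩ := ih
      have h₁ : ∃ (L : ℝ) (γ : ℝ → MetricGraph G),
          IsArcLengthCurve γ L (onEdge h s hs) (onEdge h t ht) := by
        rcases le_total s t with hst | hst
        · exact edge hs ht hst
        · obtain ⟨L, γ, hγ⟩ := edge ht hs hst
          exact ⟨L, _, hγ.symm⟩
      obtain ⟨N, γ₁, h₁⟩ := h₁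
      exact ⟨_, _, h₁.trans h₂⟩

end MetricGraph

/-! ### Hyperbolic fillings -/

/-- `S` is `r`-separated: distinct points of `S` have distance at least `r`. -/
def IsSep {Z : Type*} [MetricSpace Z] (r : ℝ) (S : Set Z) : Prop :=
  ∀ z ∈ S, ∀ z' ∈ S, z ≠ z' → r ≤ dist z z'

/-- The data from which a hyperbolic filling with parameters `α, τ > 1` of a metric space `Z` with
`diam Z < 1` is constructed: a point `z₀` and an increasing sequence of sets `A n`, where
`A 0 = {z₀}` and where `A n` is a maximal `α⁻ⁿ`-separated set for `n ≥ 1`. -/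
structure HyperbolicFilling (Z : Type*) [MetricSpace Z] (α τ : ℝ) where
  one_lt_alpha : 1 < α
  one_lt_tau : 1 < τ
  diam_lt_one : Metric.ediam (Set.univ : Set Z) < 1
  z₀ : Z
  A : ℕ → Set Z
  A_zero : A 0 = {z₀}
  A_mono : Monotone A
  A_maximal : ∀ n, 1 ≤ n → Maximal (IsSep (α ^ n)⁻¹) (A n)

namespace HyperbolicFilling

variable {Z : Type*} [MetricSpace Z] {α τ : ℝ}

/-- The vertex set: pairs `(x, n)` with `x ∈ A n`. -/
@[ext]
structure Vertex (H : HyperbolicFilling Z α τ) where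
  point : Z
  level : ℕ
  mem : point ∈ H.A level

/-- The neighbor relation: `(x, n)` and `(y, m)` are neighbors if they are different and either
`n = m` and the balls `B(x, τ α⁻ⁿ)` and `B(y, τ α⁻ᵐ)` meet, or `|n - m| = 1` and the balls
`B(x, α⁻ⁿ)` and `B(y, α⁻ᵐ)` meet. -/
def IsNeighbor (H : HyperbolicFilling Z α τ) (v w : H.Vertex) : Prop :=
  v ≠ w ∧
    ((v.level = w.level ∧
        (Metric.ball v.point (τ * (α ^ v.level)⁻¹) ∩
          Metric.ball w.point (τ * (α ^ w.level)⁻¹)).Nonempty) ∨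
      ((v.level = w.level + 1 ∨ w.level = v.level + 1) ∧
        (Metric.ball v.point (α ^ v.level)⁻¹ ∩
          Metric.ball w.point (α ^ w.level)⁻¹).Nonempty))

theorem IsNeighbor.symm {H : HyperbolicFilling Z α τ} {v w : H.Vertex} (h : H.IsNeighbor v w) :
    H.IsNeighbor w v := by
  obtain ⟨hne, ⟨h, h'⟩ | ⟨h, h'⟩⟩ := h
  · exact ⟨hne.symm, Or.inl ⟨h.symm, by rwa [Set.inter_comm]⟩⟩
  · exact ⟨hne.symm, Or.inr ⟨h.symm, by rwa [Set.inter_comm]⟩⟩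

/-- The graph with the above vertices and edges. -/
def graph (H : HyperbolicFilling Z α τ) : SimpleGraph H.Vertex where
  Adj := H.IsNeighbor
  symm := ⟨fun _ _ h => h.symm⟩
  loopless := ⟨fun _ h => h.1 rfl⟩

/-- The root `(z₀, 0)` as a vertex. -/
def rootVertex (H : HyperbolicFilling Z α τ) : H.Vertex := ⟨H.z₀, 0, by simp [H.A_zero]⟩

theorem exists_mem_dist_lt (H : HyperbolicFilling Z α τ) (n : ℕ) (x : Z) :
    ∃ y ∈ H.A n, dist x y < (α ^ n)⁻¹ := by
  have hα : 0 < α := zero_lt_one.trans H.one_lt_alpha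
  rcases Nat.eq_zero_or_pos n with rfl | hn
  · refine ⟨H.z₀, by simp [H.A_zero], ?_⟩
    have h1 : edist x H.z₀ < 1 :=
      (Metric.edist_le_ediam_of_mem (Set.mem_univ x) (Set.mem_univ _)).trans_lt H.diam_lt_one
    rw [edist_dist, ← ENNReal.ofReal_one, ENNReal.ofReal_lt_ofReal_iff zero_lt_one] at h1
    simpa using h1
  · by_contra! hcon
    have hx : x ∉ H.A n := fun hx => by
      have h1 := hcon x hx
      rw [dist_self] at h1
      have h2 : 0 < (α ^ n)⁻¹ := by positivity
      linarith
    have hmax := H.A_maximal n hn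
    have hsep : IsSep (α ^ n)⁻¹ (insert x (H.A n)) := by
      rintro a (rfl | ha) b (rfl | hb) hab
      · exact absurd rfl hab
      · exact hcon b hb
      · rw [dist_comm]
        exact hcon a ha
      · exact hmax.prop a ha b hb hab
    exact hx (hmax.le_of_ge hsep (Set.subset_insert _ _) (Set.mem_insert _ _))

theorem graph_connected (H : HyperbolicFilling Z α τ) : H.graph.Connected := by
  have hα : 0 < α := zero_lt_one.trans H.one_lt_alpha
  have key : ∀ (n : ℕ) (x : Z) (hx : x ∈ H.A n),
      H.graph.Reachable H.rootVertex ⟨x, n, hx⟩ := by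
    intro n
    induction n with
    | zero =>
      intro x hx
      have : x = H.z₀ := by simpa [H.A_zero] using hx
      subst this
      exact SimpleGraph.Reachable.refl _
    | succ n ih =>
      intro x hx
      obtain ⟨y, hy, hxy⟩ := H.exists_mem_dist_lt n x
      refine (ih y hy).trans (SimpleGraph.Adj.reachable ?_)
      change H.IsNeighbor _ _
      refine ⟨fun h => ?_, Or.inr ⟨Or.inr rfl, x, hxy, ?_⟩⟩
      · have h1 := congrArg (fun v : H.Vertex => v.level) h
        simp at h1
      · have h2 : 0 < (α ^ (n + 1))⁻¹ := by positivity
        simpa using Metric.mem_ball_self (x := x) h2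
  have : Nonempty H.Vertex := ⟨H.rootVertex⟩
  refine SimpleGraph.Connected.mk fun v w => ?_
  exact (key v.level v.point v.mem).symm.trans (key w.level w.point w.mem)

instance (H : HyperbolicFilling Z α τ) : Fact H.graph.Connected := ⟨H.graph_connected⟩

/-- The hyperbolic filling `X` as a metric space: the metric graph of the neighbor relation. -/
abbrev Space (H : HyperbolicFilling Z α τ) : Type _ := MetricGraph H.graph

/-- The root `v₀ = (z₀, 0)` as a point of the hyperbolic filling. -/
noncomputable def root (H : HyperbolicFilling Z α τ) : H.Space :=
  MetricGraph.vertex H.graph H.rootVertex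

end HyperbolicFilling

/-- The Gromov product `(x|y)_o`. -/
noncomputable def gromovProduct {X : Type*} [MetricSpace X] (o x y : X) : ℝ :=
  (dist o x + dist o y - dist x y) / 2

end HypFill

/-! Write |x| for the distance to the root and ρ = exp(-ε|·|). Everything reduces to one fact,
`HyperbolicFilling.exists_branching_point`: points x, y with d(x,y) ≥ 1 can both be joined to a
common vertex u by curves whose lengths exceed the drop in |·| by at most 3, and ρ(u) is at most a
constant times d_ε(x,y).

Given u, the rest is calculus in a complete length space. Along a curve running down to u and up
again, the weighted length is geometric in |·|. Its total is therefore comparable to ρ(u), hence to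
d_ε(x,y), and the shorter of the two pieces cut off at a point is at most a multiple of ρ there.
Since ρ(p) is in turn at most a multiple of the distance from p to the boundary in the completion,
the curve is uniform. The same descent shows that the Gromov product (x|y) is at least |u| - 3,
which gives the lower estimate of d_ε; the upper one holds in every length space.

Lower bounds for d_ε come from test functions: if f has local Lipschitz constant at most Kρ, then
|f(x) - f(y)| ≤ K e^ε d_ε(x,y). Two are used. The truncated distance ρ(p) min{d(p,·),1} gives local
control of d by d_ε and the boundary distance. The function d_Z(·,z)^σ on vertices, with σ = ε/log
α, extended affinely to edges, is admissible because neighbors near level n have points at distance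
O(α⁻ⁿ), (α⁻ⁿ)^σ = e^(-εn), and t^σ is subadditive when ε ≤ log α.

The vertex u lies at the last level k, not above those of vertices near x and y, at which τ > 1
forces their ancestors to coincide or be neighbors. Either k is the level of one of these vertices
and the first test function applies, or α⁻ᵏ is at most a multiple of their distance in Z and the
second one does. Neither geodesics nor Gromov hyperbolicity are needed. -/

namespace HypFill

/-! ### Arc length parametrization of curves with controlled increments -/

section ArcLength

theorem eVariationOn_le_of_dist_le {Y : Type*} [PseudoMetricSpace Y] {γ : ℝ → Y} {G : ℝ → ℝ}
    {S : Set ℝ} (hmono : MonotoneOn G S)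
    (h : ∀ s ∈ S, ∀ t ∈ S, s ≤ t → dist (γ s) (γ t) ≤ G t - G s) {a b : ℝ} (ha : a ∈ S)
    (hb : b ∈ S) : eVariationOn γ (S ∩ Set.Icc a b) ≤ ENNReal.ofReal (G b - G a) := by
  refine le_trans ?_ (hmono.eVariationOn_eq ha hb).le
  refine iSup_le ?_
  rintro ⟨n, u, hu, us⟩
  refine le_trans (Finset.sum_le_sum fun i _ => ?_) (eVariationOn.sum_le (f := G) hu us)
  rw [edist_comm (γ _), edist_comm (G _), edist_dist, edist_dist]
  refine ENNReal.ofReal_le_ofReal ((h _ (us i).1 _ (us (i + 1)).1 (hu i.le_succ)).trans ?_)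
  rw [dist_comm, Real.dist_eq]
  exact le_abs_self _

/-- A curve of bounded variation has an arc length parametrization, and the length of each
subcurve is controlled by any function controlling the increments. -/
theorem exists_isArcLengthCurve_of_dist_le {Y : Type*} [MetricSpace Y] {γ : ℝ → Y} {G : ℝ → ℝ}
    {L : ℝ} (hL : 0 ≤ L) (hG : ContinuousOn G (Set.Icc 0 L)) (hmono : MonotoneOn G (Set.Icc 0 L))
    (h : ∀ s ∈ Set.Icc 0 L, ∀ t ∈ Set.Icc 0 L, s ≤ t → dist (γ s) (γ t) ≤ G t - G s) :
    ∃ (L' : ℝ) (γ' : ℝ → Y), IsArcLengthCurve γ' L' (γ 0) (γ L) ∧ L' ≤ G L - G 0 ∧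
      ∀ t ∈ Set.Icc 0 L', ∃ s ∈ Set.Icc 0 L, γ' t = γ s ∧ t ≤ G s - G 0 ∧ L' - t ≤ G L - G s := by
  set S := Set.Icc 0 L with hS
  have m0 : (0 : ℝ) ∈ S := ⟨le_rfl, hL⟩
  have mL : L ∈ S := ⟨hL, le_rfl⟩
  have hvar : ∀ a ∈ S, ∀ b ∈ S, eVariationOn γ (S ∩ Set.Icc a b) ≤ ENNReal.ofReal (G b - G a) :=
    fun a ha b hb => eVariationOn_le_of_dist_le hmono h ha hb
  have hbv : LocallyBoundedVariationOn γ S := fun a b ha hb =>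
    ne_top_of_le_ne_top ENNReal.ofReal_ne_top (hvar a ha b hb)
  set v := variationOnFromTo γ S 0 with hv
  have hvle : ∀ a ∈ S, ∀ b ∈ S, a ≤ b → v b - v a ≤ G b - G a := by
    intro a ha b hb hab
    rw [hv, variationOnFromTo.sub_right hbv m0 hb ha, variationOnFromTo.eq_of_le _ _ hab]
    exact ENNReal.toReal_le_of_le_ofReal (sub_nonneg.2 (hmono ha hb hab)) (hvar a ha b hb)
  have hvmono : MonotoneOn v S := variationOnFromTo.monotoneOn hbv m0
  have v0 : v 0 = 0 := variationOnFromTo.self _ _ _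
  have hvabs : ∀ a ∈ S, ∀ b ∈ S, |v a - v b| ≤ |G a - G b| := by
    intro a ha b hb
    wlog hab : a ≤ b generalizing a b
    · rw [abs_sub_comm, abs_sub_comm (G a)]
      exact this b hb a ha (le_of_not_ge hab)
    rw [abs_sub_comm, abs_sub_comm (G a), abs_of_nonneg (sub_nonneg.2 (hvmono ha hb hab)),
      abs_of_nonneg (sub_nonneg.2 (hmono ha hb hab))]
    exact hvle a ha b hb hab
  have hvcont : ContinuousOn v S := by
    intro a ha
    rw [ContinuousWithinAt, tendsto_iff_dist_tendsto_zero]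
    have h1 := tendsto_iff_dist_tendsto_zero.1 (hG a ha)
    refine squeeze_zero' (Filter.Eventually.of_forall fun _ => dist_nonneg) ?_ h1
    filter_upwards [self_mem_nhdsWithin] with b hb
    exact hvabs b hb a ha
  -- Continuity of the variation, inherited from G, rules out jumps, so the natural parametrization
  -- is defined with unit speed on the full interval.
  have himage : v '' S = Set.Icc 0 (v L) := by
    apply Set.Subset.antisymm
    · rintro _ ⟨t, ht, rfl⟩
      exact ⟨v0 ▸ hvmono m0 ht ht.1, hvmono ht mL ht.2⟩
    · have := intermediate_value_Icc hL hvcont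
      rwa [v0] at this
  have hnat : ∀ b ∈ S, naturalParameterization γ S 0 (v b) = γ b := fun b hb =>
    edist_eq_zero.1 (edist_naturalParameterization_eq_zero hbv m0 hb)
  refine ⟨v L, naturalParameterization γ S 0, ⟨?_, ?_, ?_, hnat L mL⟩, ?_, ?_⟩
  · exact v0 ▸ hvmono m0 mL hL
  · rw [← himage]
    exact has_unit_speed_naturalParameterization γ hbv m0
  · rw [← hnat 0 m0, v0]
  · simpa [v0] using hvle 0 m0 L mL hL
  · intro t ht
    rw [← himage] at ht
    obtain ⟨s, hs, rfl⟩ := ht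
    refine ⟨s, hs, hnat s hs, ?_, hvle s hs L mL hs.2⟩
    simpa [v0] using hvle 0 m0 s hs hs.1

variable {X : Type*} [PseudoMetricSpace X] {γ : ℝ → X} {L : ℝ} {x y : X}

theorem IsArcLengthCurve.subcurve (h : IsArcLengthCurve γ L x y) {a b : ℝ}
    (ha : a ∈ Set.Icc 0 L) (hb : b ∈ Set.Icc 0 L) (hab : a ≤ b) :
    IsArcLengthCurve (fun t => γ (t + a)) (b - a) (γ a) (γ b) where
  nonneg := sub_nonneg.2 hab
  unit_speed := by
    intro c hc d hd
    have hmono : MonotoneOn (fun t : ℝ => t + a) (Set.Icc 0 (b - a) ∩ Set.Icc c d) := by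
      intro u _ v _ huv
      simpa using huv
    have k1 := eVariationOn.comp_eq_of_monotoneOn γ (fun t : ℝ => t + a) hmono
    have k2 : (fun t : ℝ => t + a) '' (Set.Icc 0 (b - a) ∩ Set.Icc c d)
        = Set.Icc 0 L ∩ Set.Icc (c + a) (d + a) := by
      rw [Set.image_inter (add_left_injective a), Set.image_add_const_Icc,
        Set.image_add_const_Icc, Set.Icc_inter_Icc, Set.Icc_inter_Icc]
      have e1 : (0 + a) ⊔ (c + a) = 0 ⊔ (c + a) := by
        rw [sup_of_le_right (by linarith [hc.1]), sup_of_le_right (by linarith [hc.1, ha.1])]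
      have e2 : (b - a + a) ⊓ (d + a) = L ⊓ (d + a) := by
        rw [inf_of_le_right (by linarith [hd.2]), inf_of_le_right (by linarith [hd.2, hb.2])]
      rw [e1, e2]
    have mc : c + a ∈ Set.Icc 0 L := ⟨by linarith [hc.1, ha.1], by linarith [hc.2, hb.2]⟩
    have md : d + a ∈ Set.Icc 0 L := ⟨by linarith [hd.1, ha.1], by linarith [hd.2, hb.2]⟩
    have k3 := h.unit_speed mc md
    have k4 : eVariationOn (fun t => γ (t + a)) (Set.Icc 0 (b - a) ∩ Set.Icc c d)
        = eVariationOn γ ((fun t : ℝ => t + a) '' (Set.Icc 0 (b - a) ∩ Set.Icc c d)) := k1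
    rw [k4, k2, k3]
    congr 2
    ring
  source := by simp
  target := by simp

theorem IsArcLengthCurve.dist_le_length (h : IsArcLengthCurve γ L x y) : dist x y ≤ L := by
  have := h.dist_le ⟨le_rfl, h.nonneg⟩ ⟨h.nonneg, le_rfl⟩
  rwa [h.source, h.target, zero_sub, abs_neg, abs_of_nonneg h.nonneg] at this

end ArcLength

/-- The density `ρ_ε(p) = exp (-ε d(p, x₀))`. -/
noncomputable def density {X : Type*} [PseudoMetricSpace X] (ε : ℝ) (x₀ p : X) : ℝ :=
  Real.exp (-ε * dist p x₀)

/-! ### The density ρ_ε and lower bounds for d_ε by test functions -/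

section Density

variable {X : Type*} [PseudoMetricSpace X] {ε : ℝ} {x₀ x y : X} {γ : ℝ → X} {L : ℝ}

theorem density_pos (p : X) : 0 < density ε x₀ p := Real.exp_pos _

theorem density_le (hε : 0 ≤ ε) {p q : X} {r : ℝ} (h : dist p q ≤ r) :
    density ε x₀ p ≤ Real.exp (ε * r) * density ε x₀ q := by
  rw [density, density, ← Real.exp_add, Real.exp_le_exp]
  nlinarith [dist_triangle q p x₀, dist_comm p q]

theorem intervalIntegrable_density (h : IsArcLengthCurve γ L x y) {a b : ℝ}
    (ha : a ∈ Set.Icc 0 L) (hb : b ∈ Set.Icc 0 L) :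
    IntervalIntegrable (fun t => density ε x₀ (γ t)) MeasureTheory.volume a b :=
  ((weightedLength_integrand_continuousOn h).mono
    (Set.ordConnected_Icc.uIcc_subset ha hb)).intervalIntegrable

theorem weightedLength_sub (h : IsArcLengthCurve γ L x y) {a b : ℝ}
    (ha : a ∈ Set.Icc 0 L) (hb : b ∈ Set.Icc 0 L) :
    weightedLength ε x₀ γ b - weightedLength ε x₀ γ a = ∫ t in a..b, density ε x₀ (γ t) := by
  have m0 : (0 : ℝ) ∈ Set.Icc 0 L := ⟨le_rfl, h.nonneg⟩
  exact intervalIntegral.integral_interval_sub_left (intervalIntegrable_density h m0 hb)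
    (intervalIntegrable_density h m0 ha)

theorem weightedLength_subcurve (h : IsArcLengthCurve γ L x y) {a b : ℝ}
    (ha : a ∈ Set.Icc 0 L) (hb : b ∈ Set.Icc 0 L) :
    weightedLength ε x₀ (fun t => γ (t + a)) (b - a)
      = weightedLength ε x₀ γ b - weightedLength ε x₀ γ a := by
  rw [weightedLength_sub h ha hb, weightedLength,
    intervalIntegral.integral_comp_add_right (fun t => Real.exp (-ε * dist (γ t) x₀))]
  simp [density]

theorem weightedLength_monotoneOn (h : IsArcLengthCurve γ L x y) :
    MonotoneOn (weightedLength ε x₀ γ) (Set.Icc 0 L) := by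
  intro a ha b hb hab
  rw [← sub_nonneg, weightedLength_sub h ha hb]
  exact intervalIntegral.integral_nonneg hab fun _ _ => (density_pos _).le

theorem weightedLength_continuousOn (h : IsArcLengthCurve γ L x y) :
    ContinuousOn (weightedLength ε x₀ γ) (Set.Icc 0 L) := by
  have := intervalIntegral.continuousOn_primitive_interval (μ := MeasureTheory.volume)
    (f := fun t => density ε x₀ (γ t)) (a := 0) (b := L) (by
      rw [Set.uIcc_of_le h.nonneg]
      exact (weightedLength_integrand_continuousOn h).integrableOn_Icc)
  rwa [Set.uIcc_of_le h.nonneg] at this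

theorem uniformizedDist_le_sub (h : IsArcLengthCurve γ L x y) {a b : ℝ}
    (ha : a ∈ Set.Icc 0 L) (hb : b ∈ Set.Icc 0 L) (hab : a ≤ b) :
    uniformizedDist ε x₀ (γ a) (γ b) ≤ weightedLength ε x₀ γ b - weightedLength ε x₀ γ a := by
  rw [← weightedLength_subcurve h ha hb]
  exact uniformizedDist_le (h.subcurve ha hb hab)

theorem weightedLength_le (hε : 0 ≤ ε) (h : IsArcLengthCurve γ L x y) :
    weightedLength ε x₀ γ L ≤ L * Real.exp (ε * L) * density ε x₀ x := by
  have m0 : (0 : ℝ) ∈ Set.Icc 0 L := ⟨le_rfl, h.nonneg⟩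
  have mL : L ∈ Set.Icc 0 L := ⟨h.nonneg, le_rfl⟩
  have := intervalIntegral.integral_mono_on h.nonneg
    (intervalIntegrable_density (ε := ε) (x₀ := x₀) h m0 mL)
    (intervalIntegrable_const (c := Real.exp (ε * L) * density ε x₀ x)) fun t ht => ?_
  · refine this.trans_eq ?_
    simp
    ring
  · apply density_le hε
    have h1 := h.dist_le ht m0
    rw [h.source, sub_zero, abs_of_nonneg ht.1] at h1
    exact h1.trans ht.2

/-- A function which is locally Lipschitz with respect to the density `ρ_ε` is Lipschitz
along curves with respect to the weighted length. -/
theorem abs_sub_le_weightedLength (hε : 0 ≤ ε) {f : X → ℝ} {K : ℝ} (hK : 0 ≤ K)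
    (hf : ∀ p q, dist p q ≤ 1 → |f p - f q| ≤ K * density ε x₀ p * dist p q)
    (h : IsArcLengthCurve γ L x y) :
    |f x - f y| ≤ K * Real.exp ε * weightedLength ε x₀ γ L := by
  -- On a piece of length at most one the density changes by a factor of at most e^ε; this is the
  -- source of that factor in the conclusion.
  have small : ∀ a ∈ Set.Icc 0 L, ∀ b ∈ Set.Icc 0 L, a ≤ b → b ≤ a + 1 →
      |f (γ a) - f (γ b)|
        ≤ K * Real.exp ε * (weightedLength ε x₀ γ b - weightedLength ε x₀ γ a) := by
    intro a ha b hb hab hab'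
    have hd : dist (γ a) (γ b) ≤ b - a := by
      have := h.dist_le ha hb
      rwa [abs_sub_comm, abs_of_nonneg (sub_nonneg.2 hab)] at this
    have h1 : (b - a) * density ε x₀ (γ a)
        ≤ Real.exp ε * (weightedLength ε x₀ γ b - weightedLength ε x₀ γ a) := by
      rw [weightedLength_sub h ha hb, ← intervalIntegral.integral_const_mul]
      have := intervalIntegral.integral_mono_on hab
        (intervalIntegrable_const (c := density ε x₀ (γ a)))
        ((intervalIntegrable_density (ε := ε) (x₀ := x₀) h ha hb).const_mul (Real.exp ε))
        fun t ht => ?_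
      · simpa using this
      · have h2 := h.dist_le ha ⟨ha.1.trans ht.1, ht.2.trans hb.2⟩
        rw [abs_sub_comm, abs_of_nonneg (sub_nonneg.2 ht.1)] at h2
        simpa using density_le (x₀ := x₀) hε (h2.trans (show t - a ≤ 1 by linarith [ht.2]))
    calc |f (γ a) - f (γ b)| ≤ K * density ε x₀ (γ a) * dist (γ a) (γ b) :=
          hf _ _ (hd.trans (by linarith))
      _ ≤ K * density ε x₀ (γ a) * (b - a) :=
          mul_le_mul_of_nonneg_left hd (mul_nonneg hK (density_pos _).le)
      _ = K * ((b - a) * density ε x₀ (γ a)) := by ring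
      _ ≤ K * (Real.exp ε * (weightedLength ε x₀ γ b - weightedLength ε x₀ γ a)) :=
          mul_le_mul_of_nonneg_left h1 hK
      _ = _ := by ring
  -- Longer pieces are handled by repeatedly cutting off a last piece of length at most one.
  have key : ∀ (n : ℕ), ∀ b ∈ Set.Icc 0 L, b ≤ n →
      |f (γ 0) - f (γ b)| ≤ K * Real.exp ε * weightedLength ε x₀ γ b := by
    intro n
    induction n with
    | zero =>
      intro b hb hbn
      obtain rfl : b = 0 := le_antisymm (by simpa using hbn) hb.1
      simp [weightedLength]
    | succ n ih =>
      intro b hb hbn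
      push_cast at hbn
      have hc : max 0 (b - 1) ∈ Set.Icc 0 L :=
        ⟨le_max_left _ _, max_le h.nonneg (by linarith [hb.2])⟩
      have h1 := ih (max 0 (b - 1)) hc (max_le n.cast_nonneg (by linarith))
      have h2 := small _ hc b hb (max_le hb.1 (by linarith))
        (by linarith [le_max_right 0 (b - 1)])
      refine (abs_sub_le _ (f (γ (max 0 (b - 1)))) _).trans ((add_le_add h1 h2).trans_eq ?_)
      ring
  obtain ⟨n, hn⟩ := exists_nat_ge L
  have := key n L ⟨h.nonneg, le_rfl⟩ hn
  rwa [h.source, h.target] at this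

/-- The bound along a single curve passes to the infimum. The lower bounds for d_ε below all go back
to this, through a choice of f. -/
theorem abs_sub_le_uniformizedDist [RectifiablyConnected X] (hε : 0 ≤ ε) {f : X → ℝ} {K : ℝ}
    (hK : 0 < K) (hf : ∀ p q, dist p q ≤ 1 → |f p - f q| ≤ K * density ε x₀ p * dist p q)
    (x y : X) : |f x - f y| ≤ K * Real.exp ε * uniformizedDist ε x₀ x y := by
  have hpos : 0 < K * Real.exp ε := mul_pos hK (Real.exp_pos _)
  rw [← div_le_iff₀' hpos]
  refine le_uniformizedDist fun L γ h => ?_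
  rw [div_le_iff₀' hpos]
  exact abs_sub_le_weightedLength hε hK.le hf h

/-- The test function is ρ(p) min{d(p,·),1}. Within distance 2 of p its Lipschitz constant ρ(p) is
at most e^(2ε) times the local density, and farther out it is constant at unit scale; one more
factor e^ε comes from the passage to curves. -/
theorem density_mul_min_le_uniformizedDist [RectifiablyConnected X] (hε : 0 ≤ ε) (p q : X) :
    density ε x₀ p * min (dist p q) 1 ≤ Real.exp (3 * ε) * uniformizedDist ε x₀ p q := by
  have := abs_sub_le_uniformizedDist (x₀ := x₀) hε
    (f := fun u => density ε x₀ p * min (dist p u) 1) (Real.exp_pos (2 * ε)) (fun u w huw => ?_) p q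
  · rw [← Real.exp_add, dist_self, min_eq_left zero_le_one, mul_zero, zero_sub, abs_neg] at this
    rw [show 3 * ε = 2 * ε + ε by ring]
    exact (le_abs_self _).trans this
  · rw [← mul_sub, abs_mul, abs_of_pos (density_pos p)]
    have hmin : |min (dist p u) 1 - min (dist p w) 1| ≤ dist u w :=
      (abs_min_sub_min_le_max _ _ _ _).trans
        (max_le (by simpa [dist_comm p] using abs_dist_sub_le u w p) (by simp))
    rcases le_total (dist p u) 2 with h2 | h2
    · refine mul_le_mul ?_ hmin (abs_nonneg _)
        (mul_pos (Real.exp_pos _) (density_pos u)).le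
      rw [mul_comm 2]
      exact density_le hε h2
    · rw [min_eq_right (by linarith), min_eq_right (by linarith [dist_triangle p w u, dist_comm u w])]
      simp only [sub_self, abs_zero, mul_zero]
      have := density_pos (ε := ε) (x₀ := x₀) u
      positivity

end Density

/-- `X` is a length space: the distance is the infimum of the lengths of curves. -/
def IsLengthMetric (X : Type*) [PseudoMetricSpace X] : Prop :=
  ∀ (x y : X) (r : ℝ), dist x y < r → ∃ (L : ℝ) (γ : ℝ → X), IsArcLengthCurve γ L x y ∧ L < r

/-! ### Weighted length of curves that descend and then ascend -/

section Turning

variable {X : Type*} [PseudoMetricSpace X] {ε : ℝ} {x₀ x y : X} {γ : ℝ → X} {L : ℝ}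

theorem weightedLength_reverse (h : IsArcLengthCurve γ L x y) {s : ℝ} (hs : s ∈ Set.Icc 0 L) :
    weightedLength ε x₀ (fun t => γ (L - t)) (L - s)
      = weightedLength ε x₀ γ L - weightedLength ε x₀ γ s := by
  rw [weightedLength_sub h hs ⟨h.nonneg, le_rfl⟩, weightedLength,
    intervalIntegral.integral_comp_sub_left (fun t => Real.exp (-ε * dist (γ t) x₀))]
  simp [density]

/-- At time u the curve is still at distance at least d(x,x₀) - u from x₀. The resulting exponential
majorant is integrated exactly and its positive value at 0 is discarded. -/
theorem weightedLength_le_exp (hε : 0 < ε) (h : IsArcLengthCurve γ L x y) {s : ℝ}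
    (hs : s ∈ Set.Icc 0 L) :
    weightedLength ε x₀ γ s ≤ 1 / ε * Real.exp (-ε * (dist x x₀ - s)) := by
  have m0 : (0 : ℝ) ∈ Set.Icc 0 L := ⟨le_rfl, h.nonneg⟩
  have hderiv : ∀ u ∈ Set.uIcc 0 s, HasDerivAt
      (fun u => 1 / ε * Real.exp (-ε * (dist x x₀ - u)))
      (Real.exp (-ε * (dist x x₀ - u))) u := by
    intro u _
    have h1 := ((((hasDerivAt_id u).const_sub (dist x x₀)).const_mul (-ε)).exp).const_mul (1 / ε)
    refine h1.congr_deriv ?_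
    simp only [id_eq]
    field_simp
  have hcont : Continuous fun u => Real.exp (-ε * (dist x x₀ - u)) := by fun_prop
  have hint := intervalIntegral.integral_eq_sub_of_hasDerivAt hderiv
    (hcont.intervalIntegrable 0 s)
  have hle : weightedLength ε x₀ γ s ≤ ∫ u in (0 : ℝ)..s, Real.exp (-ε * (dist x x₀ - u)) := by
    refine intervalIntegral.integral_mono_on hs.1 (intervalIntegrable_density h m0 hs)
      (hcont.intervalIntegrable 0 s) fun u hu => ?_
    rw [Real.exp_le_exp]
    have h1 := h.dist_le m0 ⟨hu.1, hu.2.trans hs.2⟩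
    rw [h.source, zero_sub, abs_neg, abs_of_nonneg hu.1] at h1
    nlinarith [dist_triangle x (γ u) x₀]
  rw [hint] at hle
  have : 0 < 1 / ε * Real.exp (-ε * (dist x x₀ - 0)) := by positivity
  linarith

theorem weightedLength_sub_le_exp (hε : 0 < ε) (h : IsArcLengthCurve γ L x y) {s : ℝ}
    (hs : s ∈ Set.Icc 0 L) :
    weightedLength ε x₀ γ L - weightedLength ε x₀ γ s
      ≤ 1 / ε * Real.exp (-ε * (dist y x₀ - (L - s))) := by
  rw [← weightedLength_reverse h hs]
  exact weightedLength_le_exp hε h.symm ⟨by linarith [hs.2], by linarith [hs.1]⟩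

/-- If L = d(x,y), the exponent is -ε times the Gromov product, so this serves both the upper
estimate of d_ε and the length bound for uniform curves. -/
theorem weightedLength_le_exp_half (hε : 0 < ε) (h : IsArcLengthCurve γ L x y) :
    weightedLength ε x₀ γ L
      ≤ 2 / ε * Real.exp (-ε * ((dist x x₀ + dist y x₀ - L) / 2)) := by
  have hL := h.dist_le_length
  -- The cut is placed where the exponential bounds from the two ends agree.
  have hs : (dist x x₀ - dist y x₀ + L) / 2 ∈ Set.Icc 0 L :=
    ⟨by linarith [dist_triangle y x x₀, dist_comm x y], by linarith [dist_triangle x y x₀]⟩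
  have h1 := weightedLength_le_exp (x₀ := x₀) hε h hs
  have h2 := weightedLength_sub_le_exp (x₀ := x₀) hε h hs
  rw [show dist x x₀ - (dist x x₀ - dist y x₀ + L) / 2 = (dist x x₀ + dist y x₀ - L) / 2 by
    ring] at h1
  rw [show dist y x₀ - (L - (dist x x₀ - dist y x₀ + L) / 2)
    = (dist x x₀ + dist y x₀ - L) / 2 by ring] at h2
  have h3 := add_le_add h1 h2
  rw [add_sub_cancel] at h3
  refine h3.trans_eq ?_
  ring

/-- Near-optimal descent up to time a forces near-optimal descent up to each earlier s: d(γ(s),x₀) ≤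
d(x,x₀) - s + C₀. Hence the geometric bound from the starting point is a multiple of the density at
γ(s). -/
theorem weightedLength_le_of_descending (hε : 0 < ε) {C₀ : ℝ} (h : IsArcLengthCurve γ L x y)
    {a : ℝ} (ha : a ∈ Set.Icc 0 L) (hdesc : a ≤ dist x x₀ - dist (γ a) x₀ + C₀) {s : ℝ}
    (hs : s ∈ Set.Icc 0 a) :
    weightedLength ε x₀ γ s ≤ 1 / ε * Real.exp (ε * C₀) * density ε x₀ (γ s) := by
  have hsL : s ∈ Set.Icc 0 L := ⟨hs.1, hs.2.trans ha.2⟩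
  refine (weightedLength_le_exp hε h hsL).trans ?_
  rw [density, mul_assoc, ← Real.exp_add]
  refine mul_le_mul_of_nonneg_left (Real.exp_le_exp.2 ?_) (by positivity)
  have h1 := h.dist_le hsL ha
  rw [abs_sub_comm, abs_of_nonneg (sub_nonneg.2 hs.2)] at h1
  nlinarith [dist_triangle (γ s) (γ a) x₀]

/-- A curve which descends towards `x₀`, up to an additive constant, until the parameter `a`, and
ascends afterwards, satisfies the twisted cone condition with respect to the weighted length. -/
theorem min_weightedLength_le_of_turning (hε : 0 < ε) {C₀ : ℝ} (h : IsArcLengthCurve γ L x y)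
    {a : ℝ} (ha : a ∈ Set.Icc 0 L) (hx : a ≤ dist x x₀ - dist (γ a) x₀ + C₀)
    (hy : L - a ≤ dist y x₀ - dist (γ a) x₀ + C₀) {s : ℝ} (hs : s ∈ Set.Icc 0 L) :
    min (weightedLength ε x₀ γ s) (weightedLength ε x₀ γ L - weightedLength ε x₀ γ s)
      ≤ 1 / ε * Real.exp (ε * C₀) * density ε x₀ (γ s) := by
  rcases le_total s a with hsa | hsa
  · exact (min_le_left _ _).trans (weightedLength_le_of_descending hε h ha hx ⟨hs.1, hsa⟩)
  · refine (min_le_right _ _).trans ?_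
    have := weightedLength_le_of_descending (x₀ := x₀) (C₀ := C₀) hε h.symm (a := L - a)
      (s := L - s) ⟨by linarith [ha.2], by linarith [ha.1]⟩ (by simpa using hy)
      ⟨by linarith [hs.2], by linarith⟩
    rwa [weightedLength_reverse h hs, sub_sub_cancel] at this

end Turning

/-! ### Uniformity and Gromov product estimates in length spaces -/

section Uniformity

variable {X : Type*} [MetricSpace X] [RectifiablyConnected X] {ε : ℝ} {x₀ : X}

omit [RectifiablyConnected X] in
theorem IsLengthMetric.uniformizedDist_le_dist (hX : IsLengthMetric X) (hε : 0 ≤ ε) (x y : X) :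
    uniformizedDist ε x₀ x y ≤ dist x y := by
  refine le_of_forall_pos_le_add fun δ hδ => ?_
  obtain ⟨L, γ, h, hL⟩ := hX x y (dist x y + δ) (by linarith)
  refine ((uniformizedDist_le h).trans ?_).trans hL.le
  have := intervalIntegral.integral_mono_on h.nonneg
    (intervalIntegrable_density (ε := ε) (x₀ := x₀) h ⟨le_rfl, h.nonneg⟩ ⟨h.nonneg, le_rfl⟩)
    (intervalIntegrable_const (c := 1)) fun t _ => ?_
  · exact this.trans_eq (by simp)
  · rw [density, Real.exp_le_one_iff]
    nlinarith [dist_nonneg (x := γ t) (y := x₀)]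

/-- A point of `X` as a point of the uniformization. -/
def toUniformization (x₀ : X) (ε : ℝ) (x : X) : Uniformization X x₀ ε := x

omit [RectifiablyConnected X] in
theorem dist_toUniformization (x y : X) :
    dist (toUniformization x₀ ε x) (toUniformization x₀ ε y) = uniformizedDist ε x₀ x y := rfl

open UniformSpace in
/-- A point of the completion of the uniformization which is not in `X` has distance at least
a fixed multiple of `ρ_ε(p)` from `p`. -/
theorem mem_range_coe_of_dist_lt [CompleteSpace X] (hX : IsLengthMetric X) (hε : 0 ≤ ε)
    (p : X) (ζ : Completion (Uniformization X x₀ ε))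
    (h : dist (toUniformization x₀ ε p : Completion (Uniformization X x₀ ε)) ζ
      < Real.exp (-(3 * ε)) * density ε x₀ p) :
    ζ ∈ Set.range ((↑) : Uniformization X x₀ ε → Completion (Uniformization X x₀ ε)) := by
  obtain ⟨u, hu, hlim⟩ := mem_closure_iff_seq_limit.1
    (Completion.denseRange_coe (α := Uniformization X x₀ ε) ζ)
  obtain ⟨r, hr⟩ : ∃ r : ℕ → X, ∀ n, ↑(toUniformization x₀ ε (r n)) = u n :=
    Classical.skolem.1 hu
  obtain rfl : (fun n => (toUniformization x₀ ε (r n) : Completion (Uniformization X x₀ ε))) = u :=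
    funext hr
  -- Leaving the unit ball about p costs at least e^(-3ε) ρ(p) in d_ε, which the hypothesis excludes
  -- for the tail.
  have hnear : ∀ᶠ n in Filter.atTop, dist p (r n) ≤ 1 := by
    filter_upwards [(tendsto_const_nhds.dist hlim).eventually (gt_mem_nhds h)] with n h2
    rw [Completion.dist_eq, dist_toUniformization] at h2
    by_contra! hcon
    have h1 := density_mul_min_le_uniformizedDist (x₀ := x₀) hε p (r n)
    rw [min_eq_right hcon.le, mul_one] at h1
    rw [Real.exp_neg, ← div_eq_inv_mul, lt_div_iff₀' (Real.exp_pos _)] at h2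
    linarith
  obtain ⟨N, hN⟩ := Filter.eventually_atTop.1 hnear
  have hcs := hlim.cauchySeq
  -- In this unit ball ρ is at least e^(-ε) ρ(p), so d_ε dominates e^(-4ε) ρ(p) min{d,1} and Cauchy
  -- sequences for d_ε are Cauchy for d. Completeness of X gives a limit, which is also a limit for
  -- d_ε because d_ε ≤ d.
  have hcX : CauchySeq r := by
    rw [Metric.cauchySeq_iff] at hcs ⊢
    intro η hη
    set c := Real.exp (-(4 * ε)) * density ε x₀ p with hc
    have hcpos : 0 < c := mul_pos (Real.exp_pos _) (density_pos _)
    obtain ⟨M, hM⟩ := hcs (c * min η 1) (by positivity)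
    refine ⟨max M N, fun m hm n hn => ?_⟩
    have h1 := hM m (le_of_max_le_left hm) n (le_of_max_le_left hn)
    rw [Completion.dist_eq, dist_toUniformization] at h1
    have h2 := density_mul_min_le_uniformizedDist (x₀ := x₀) hε (r m) (r n)
    have h3 : density ε x₀ p ≤ Real.exp ε * density ε x₀ (r m) := by
      simpa using density_le (x₀ := x₀) hε (hN m (le_of_max_le_right hm))
    have h4 : c * min (dist (r m) (r n)) 1 < c * min η 1 := by
      refine lt_of_le_of_lt ?_ h1
      have h5 : Real.exp (4 * ε) * c = density ε x₀ p := by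
        rw [hc, ← mul_assoc, ← Real.exp_add]
        simp
      have h6 : Real.exp (4 * ε) = Real.exp ε * Real.exp (3 * ε) := by
        rw [← Real.exp_add]
        ring_nf
      rw [← mul_le_mul_iff_right₀ (Real.exp_pos (4 * ε)), ← mul_assoc, h5]
      refine (mul_le_mul_of_nonneg_right h3 (by positivity)).trans ?_
      rw [h6, mul_assoc, mul_assoc]
      exact mul_le_mul_of_nonneg_left h2 (Real.exp_pos _).le
    have h7 := lt_of_mul_lt_mul_left h4 hcpos.le
    rcases min_lt_iff.1 h7 with h8 | h8
    · exact h8.trans_le (min_le_left _ _)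
    · exact absurd (h8.trans_le (min_le_right _ _)) (lt_irrefl _)
  obtain ⟨z, hz⟩ := cauchySeq_tendsto_of_complete hcX
  have hz' : Filter.Tendsto (fun n => toUniformization x₀ ε (r n)) Filter.atTop
      (nhds (toUniformization x₀ ε z)) :=
    tendsto_iff_dist_tendsto_zero.2 (squeeze_zero (fun _ => dist_nonneg)
      (fun n => hX.uniformizedDist_le_dist hε _ _) (tendsto_iff_dist_tendsto_zero.1 hz))
  exact ⟨toUniformization x₀ ε z,
    tendsto_nhds_unique (((Completion.continuous_coe _).tendsto _).comp hz') hlim⟩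

open UniformSpace in
-- Reparametrized by d_ε-arc length in the completion, such curves are uniform: the cone condition
-- relative to ρ becomes one relative to the boundary distance, which is at least e^(-3ε) ρ.
theorem isUniformMetricSpace_of_curves [CompleteSpace X] (hX : IsLengthMetric X) (hε : 0 ≤ ε)
    {A B : ℝ} (hB : 0 ≤ B) (hA : 1 ≤ A) (hBA : B * Real.exp (3 * ε) ≤ A)
    (hnc : ¬ CompleteSpace (Uniformization X x₀ ε))
    (hcurve : ∀ x y : X, ∃ (L : ℝ) (γ : ℝ → X), IsArcLengthCurve γ L x y ∧
      weightedLength ε x₀ γ L ≤ B * uniformizedDist ε x₀ x y ∧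
      ∀ s ∈ Set.Icc 0 L,
        min (weightedLength ε x₀ γ s) (weightedLength ε x₀ γ L - weightedLength ε x₀ γ s)
          ≤ B * density ε x₀ (γ s)) :
    IsUniformMetricSpace A (Uniformization X x₀ ε) := by
  set U := Uniformization X x₀ ε with hU
  have hne : Set.range ((↑) : U → Completion U) ≠ Set.univ := by
    intro h
    refine hnc ?_
    have h1 : IsComplete (Set.range ((↑) : U → Completion U)) := h ▸ isComplete_univ
    have h2 := ((Completion.isUniformInducing_coe U).isComplete_iff (s := Set.univ)).1
      (by rwa [Set.image_univ])
    exact completeSpace_iff_isComplete_univ.2 h2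
  refine ⟨hnc, hA, Set.range_nonempty (ι := U) (h := ⟨x₀⟩) _, ?_, hne, ?_⟩
  · rw [Metric.isOpen_iff]
    rintro _ ⟨u, rfl⟩
    obtain ⟨p, rfl⟩ : ∃ p : X, toUniformization x₀ ε p = u := ⟨u, rfl⟩
    refine ⟨Real.exp (-(3 * ε)) * density ε x₀ p, mul_pos (Real.exp_pos _) (density_pos p), fun ζ hζ => ?_⟩
    rw [Metric.mem_ball, dist_comm] at hζ
    exact mem_range_coe_of_dist_lt hX hε p ζ hζ
  · rintro _ ⟨x, rfl⟩ _ ⟨y, rfl⟩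
    obtain ⟨L, γ, h, hlen, hmin⟩ := hcurve x y
    have hm0 : weightedLength ε x₀ γ 0 = 0 := by simp [weightedLength]
    obtain ⟨L', γ', h', hL', hsub⟩ := exists_isArcLengthCurve_of_dist_le
      (Y := Completion U) (γ := fun t => (toUniformization x₀ ε (γ t) : Completion U)) h.nonneg
      (weightedLength_continuousOn (ε := ε) (x₀ := x₀) h)
      (weightedLength_monotoneOn h) (fun s hs t ht hst => by
        rw [Completion.dist_eq]
        exact uniformizedDist_le_sub h hs ht hst)
    simp only [h.source, h.target] at h'
    rw [hm0, sub_zero] at hL'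
    have hBA' : B ≤ A := by
      have : 1 ≤ Real.exp (3 * ε) := Real.one_le_exp (by positivity)
      nlinarith
    refine ⟨L', γ', h', ?_, ?_, ?_⟩
    · intro t ht
      obtain ⟨s, hs, e, -⟩ := hsub t ht
      exact ⟨_, e.symm⟩
    · rw [Completion.dist_eq]
      exact (hL'.trans hlen).trans (mul_le_mul_of_nonneg_right hBA' (dist_nonneg (x := x) (y := y)))
    · intro t ht
      obtain ⟨s, hs, e, h1, h2⟩ := hsub t ht
      rw [hm0, sub_zero] at h1
      -- The d_ε-lengths t and L' - t of the two pieces are at most their weighted lengths, so the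
      -- cone condition survives reparametrization.
      have h3 := (min_le_min h1 h2).trans (hmin s hs)
      have h4 : Real.exp (-(3 * ε)) * density ε x₀ (γ s) ≤
          Metric.infDist (γ' t) (Set.range ((↑) : U → Completion U))ᶜ := by
        rw [Metric.le_infDist (Set.nonempty_compl.2 hne)]
        intro ζ hζ
        by_contra! hcon
        rw [e] at hcon
        exact hζ (mem_range_coe_of_dist_lt hX hε (γ s) ζ hcon)
      refine le_trans ?_ h4
      rw [one_div, inv_mul_le_iff₀ (by linarith), Real.exp_neg]
      refine h3.trans ?_
      rw [← mul_assoc, ← div_eq_mul_inv]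
      refine mul_le_mul_of_nonneg_right ?_ (density_pos _).le
      rwa [le_div_iff₀ (Real.exp_pos _)]

variable {C₀ D : ℝ}

/-- For distant points the curve goes through u; its length is at most |x| + |y| - 2|u| + 2C₀, so
its weighted length is at most a multiple of ρ(u). For close points an almost shortest curve serves,
as ρ is nearly constant on it. -/
theorem exists_curve_of_descending (hX : IsLengthMetric X) (hε : 0 < ε) (hC₀ : 3 ≤ C₀)
    (hdesc : ∀ x y : X, 1 ≤ dist x y → ∃ u : X,
      (∃ (N : ℝ) (γ : ℝ → X), IsArcLengthCurve γ N x u ∧ N ≤ dist x x₀ - dist u x₀ + C₀) ∧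
      (∃ (N : ℝ) (γ : ℝ → X), IsArcLengthCurve γ N y u ∧ N ≤ dist y x₀ - dist u x₀ + C₀) ∧
      density ε x₀ u ≤ D * uniformizedDist ε x₀ x y) (x y : X) :
    ∃ (L : ℝ) (γ : ℝ → X), IsArcLengthCurve γ L x y ∧
      weightedLength ε x₀ γ L ≤ max (2 * Real.exp (5 * ε)) (2 / ε * (Real.exp (ε * C₀) * D))
        * uniformizedDist ε x₀ x y ∧
      ∀ s ∈ Set.Icc 0 L,
        min (weightedLength ε x₀ γ s) (weightedLength ε x₀ γ L - weightedLength ε x₀ γ s)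
          ≤ 1 / ε * Real.exp (ε * C₀) * density ε x₀ (γ s) := by
  have hdnn : 0 ≤ uniformizedDist ε x₀ x y := dist_nonneg (α := Uniformization X x₀ ε)
  rcases eq_or_ne x y with rfl | hxy
  · refine ⟨0, _, IsArcLengthCurve.refl x, ?_, ?_⟩
    · rw [uniformizedDist_self]
      simp [weightedLength]
    · intro s hs
      obtain rfl : s = 0 := le_antisymm hs.2 hs.1
      have := density_pos (ε := ε) (x₀ := x₀) x
      simp only [weightedLength, intervalIntegral.integral_same, sub_self, min_self]
      positivity
  rcases le_total 1 (dist x y) with hd | hd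
  · obtain ⟨u, ⟨N₁, γ₁, h₁, hN₁⟩, ⟨N₂, γ₂, h₂, hN₂⟩, hu⟩ := hdesc x y hd
    have h := h₁.trans h₂.symm
    refine ⟨_, _, h, ?_, fun s hs => ?_⟩
    · refine (weightedLength_le_exp_half hε h).trans ?_
      refine le_trans ?_ (mul_le_mul_of_nonneg_right (le_max_right _ _) hdnn)
      rw [mul_assoc, mul_assoc]
      refine mul_le_mul_of_nonneg_left ?_ (by positivity)
      refine le_trans ?_ (mul_le_mul_of_nonneg_left hu (Real.exp_pos _).le)
      rw [density, ← Real.exp_add, Real.exp_le_exp]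
      nlinarith
    · refine min_weightedLength_le_of_turning hε h (a := N₁) ⟨h₁.nonneg, ?_⟩ ?_ ?_ hs
      · linarith [h₂.nonneg]
      · simpa [h₁.target] using hN₁
      · simpa [h₁.target] using hN₂
  · have hd0 : 0 < dist x y := dist_pos.2 hxy
    obtain ⟨L, γ, h, hL⟩ := hX x y (2 * dist x y) (by linarith)
    refine ⟨L, γ, h, ?_, fun s hs => ?_⟩
    · refine (weightedLength_le hε.le h).trans ?_
      refine le_trans ?_ (mul_le_mul_of_nonneg_right (le_max_left _ _) hdnn)
      have h1 := density_mul_min_le_uniformizedDist (x₀ := x₀) hε.le x y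
      rw [min_eq_left hd] at h1
      have h2 : L * Real.exp (ε * L) ≤ 2 * dist x y * Real.exp (ε * 2) := by
        refine mul_le_mul hL.le (Real.exp_le_exp.2 ?_) (Real.exp_pos _).le (by positivity)
        nlinarith
      calc L * Real.exp (ε * L) * density ε x₀ x
          ≤ 2 * dist x y * Real.exp (ε * 2) * density ε x₀ x :=
            mul_le_mul_of_nonneg_right h2 (density_pos _).le
        _ = 2 * Real.exp (ε * 2) * (density ε x₀ x * dist x y) := by ring
        _ ≤ 2 * Real.exp (ε * 2) * (Real.exp (3 * ε) * uniformizedDist ε x₀ x y) :=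
            mul_le_mul_of_nonneg_left h1 (by positivity)
        _ = 2 * (Real.exp (ε * 2) * Real.exp (3 * ε)) * uniformizedDist ε x₀ x y := by ring
        _ = _ := by
            rw [← Real.exp_add]
            ring_nf
    -- The whole curve counts as descending: L ≤ 2 and |x| - |y| ≥ -1, which is where 3 ≤ C₀ is
    -- needed.
    · refine min_weightedLength_le_of_turning hε h (a := L) ⟨h.nonneg, le_rfl⟩ ?_ ?_ hs
      · rw [h.target]
        linarith [dist_triangle y x x₀, dist_comm x y]
      · rw [h.target]
        linarith

omit [RectifiablyConnected X] in
theorem gromovProduct_eq (x y : X) :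
    gromovProduct x₀ x y = (dist x x₀ + dist y x₀ - dist x y) / 2 := by
  rw [gromovProduct, dist_comm x₀, dist_comm x₀]

omit [RectifiablyConnected X] in
theorem uniformizedDist_le_gromovProduct (hX : IsLengthMetric X) (hε : 0 < ε) (x y : X) :
    uniformizedDist ε x₀ x y ≤ max (2 * Real.exp (2 * ε)) (2 / ε * Real.exp ε)
      * (Real.exp (-ε * gromovProduct x₀ x y) * min (dist x y) 1) := by
  rcases eq_or_ne x y with rfl | hxy
  · simp [uniformizedDist_self]
  rw [gromovProduct_eq]
  rcases le_total (dist x y) 1 with hd | hd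
  · have hd0 : 0 < dist x y := dist_pos.2 hxy
    obtain ⟨L, γ, h, hL⟩ := hX x y (2 * dist x y) (by linarith)
    refine ((uniformizedDist_le h).trans (weightedLength_le hε.le h)).trans ?_
    refine le_trans ?_ (mul_le_mul_of_nonneg_right (le_max_left _ _) (by positivity))
    rw [min_eq_left hd]
    have h1 : density ε x₀ x ≤ Real.exp (-ε * ((dist x x₀ + dist y x₀ - dist x y) / 2)) := by
      rw [density, Real.exp_le_exp]
      nlinarith [dist_triangle y x x₀, dist_comm x y]
    have h2 : L * Real.exp (ε * L) ≤ 2 * dist x y * Real.exp (2 * ε) := by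
      refine mul_le_mul hL.le (Real.exp_le_exp.2 ?_) (Real.exp_pos _).le (by positivity)
      nlinarith
    refine (mul_le_mul h2 h1 (density_pos _).le (by positivity)).trans_eq ?_
    ring
  -- Exceeding the distance by at most one costs a factor e^(ε/2), absorbed in e^ε.
  · obtain ⟨L, γ, h, hL⟩ := hX x y (dist x y + 1) (by linarith)
    refine ((uniformizedDist_le h).trans (weightedLength_le_exp_half hε h)).trans ?_
    refine le_trans ?_ (mul_le_mul_of_nonneg_right (le_max_right _ _) (by positivity))
    rw [min_eq_right hd, mul_one, mul_assoc, ← Real.exp_add]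
    refine mul_le_mul_of_nonneg_left (Real.exp_le_exp.2 ?_) (by positivity)
    nlinarith

/-- For distant points, joining x to y through u gives d(x,y) ≤ |x| + |y| - 2|u| + 2C₀, that is,
(x|y) ≥ |u| - C₀. For close points (x|y) ≥ |x| - 1 and the truncated distance estimate suffices. -/
theorem gromovProduct_le_uniformizedDist
    (hε : 0 < ε)
    (hdesc : ∀ x y : X, 1 ≤ dist x y → ∃ u : X,
      (∃ (N : ℝ) (γ : ℝ → X), IsArcLengthCurve γ N x u ∧ N ≤ dist x x₀ - dist u x₀ + C₀) ∧
      (∃ (N : ℝ) (γ : ℝ → X), IsArcLengthCurve γ N y u ∧ N ≤ dist y x₀ - dist u x₀ + C₀) ∧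
      density ε x₀ u ≤ D * uniformizedDist ε x₀ x y) (x y : X) :
    Real.exp (-ε * gromovProduct x₀ x y) * min (dist x y) 1
      ≤ max (Real.exp (4 * ε)) (Real.exp (ε * C₀) * D) * uniformizedDist ε x₀ x y := by
  have hdnn : 0 ≤ uniformizedDist ε x₀ x y := dist_nonneg (α := Uniformization X x₀ ε)
  rw [gromovProduct_eq]
  rcases le_total (dist x y) 1 with hd | hd
  · refine le_trans ?_ (mul_le_mul_of_nonneg_right (le_max_left _ _) hdnn)
    have h1 := density_mul_min_le_uniformizedDist (x₀ := x₀) hε.le x y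
    have h2 : Real.exp (-ε * ((dist x x₀ + dist y x₀ - dist x y) / 2))
        ≤ Real.exp ε * density ε x₀ x := by
      rw [density, ← Real.exp_add, Real.exp_le_exp]
      nlinarith [dist_triangle x y x₀]
    refine (mul_le_mul_of_nonneg_right h2 (by positivity)).trans ?_
    rw [mul_assoc, show 4 * ε = ε + 3 * ε by ring, Real.exp_add, mul_assoc]
    exact mul_le_mul_of_nonneg_left h1 (Real.exp_pos _).le
  · refine le_trans ?_ (mul_le_mul_of_nonneg_right (le_max_right _ _) hdnn)
    obtain ⟨u, ⟨N₁, γ₁, h₁, hN₁⟩, ⟨N₂, γ₂, h₂, hN₂⟩, hu⟩ := hdesc x y hd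
    have h3 := (h₁.trans h₂.symm).dist_le_length
    rw [min_eq_right hd, mul_one, mul_assoc]
    refine le_trans ?_ (mul_le_mul_of_nonneg_left hu (Real.exp_pos _).le)
    rw [density, ← Real.exp_add, Real.exp_le_exp]
    nlinarith

end Uniformity

/-! ### Metric graphs: length metric, completeness, affine functions -/

namespace MetricGraph

variable {V : Type*} {G : SimpleGraph V}

theorem edgePoint_symm (v w : V) (t : ℝ) : edgePoint v w t = edgePoint w v (1 - t) := by
  rw [edgePoint, edgePoint, add_comm, sub_sub_cancel]

theorem onEdge_congr {v w : V} (h : G.Adj v w) {s t : ℝ} (hs : s ∈ Set.Icc (0 : ℝ) 1)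
    (ht : t ∈ Set.Icc (0 : ℝ) 1) (hst : s = t) : onEdge h s hs = onEdge h t ht := by
  subst hst
  rfl

theorem onEdge_apply_left {v w : V} (h : G.Adj v w) {t : ℝ} (ht : t ∈ Set.Icc (0 : ℝ) 1) :
    (onEdge h t ht).1 v = 1 - t := by
  classical
  simp [onEdge, edgePoint, h.ne']

theorem onEdge_apply_of_ne {v w u : V} (h : G.Adj v w) {t : ℝ} (ht : t ∈ Set.Icc (0 : ℝ) 1)
    (hv : v ≠ u) (hw : w ≠ u) : (onEdge h t ht).1 u = 0 := by
  classical
  simp [onEdge, edgePoint, hv, hw]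

theorem eq_vertex_or_onEdge_of_pos {p : MetricGraph G} {v : V} (hp : 0 < p.1 v) :
    p = vertex G v ∨ ∃ (w : V) (h : G.Adj v w) (t : ℝ) (ht : t ∈ Set.Icc (0 : ℝ) 1),
      p = onEdge h t ht := by
  classical
  obtain ⟨p, a, b, hab, t, ht, rfl⟩ := p
  have hv : a = v ∨ b = v := by
    by_contra! hcon
    simp [edgePoint, hcon.1, hcon.2] at hp
  rcases hab with rfl | hab
  · obtain rfl : a = v := by simpa using hv
    left
    apply Subtype.ext
    simp [vertex, edgePoint]
  · right
    rcases hv with rfl | rfl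
    · exact ⟨b, hab, t, ht, rfl⟩
    · exact ⟨a, hab.symm, 1 - t, ⟨by linarith [ht.2], by linarith [ht.1]⟩,
        Subtype.ext (edgePoint_symm _ _ _)⟩

theorem exists_half_le (p : MetricGraph G) : ∃ v, 1 / 2 ≤ p.1 v := by
  classical
  obtain ⟨p, a, b, -, t, ht, rfl⟩ := p
  rcases le_total t (1 / 2) with h | h
  · refine ⟨a, ?_⟩
    by_cases hab : b = a
    · simp [edgePoint, hab]
      norm_num
    · simp only [edgePoint, Finsupp.add_apply, Finsupp.single_apply, hab, if_true, if_false]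
      linarith
  · refine ⟨b, ?_⟩
    by_cases hab : a = b
    · simp [edgePoint, hab]
      norm_num
    · simp only [edgePoint, Finsupp.add_apply, Finsupp.single_apply, hab, if_true, if_false]
      linarith

/-- Each linear piece is parametrized isometrically. Keeping track of the exact length is what makes
the path metric a length metric. -/
theorem IsPathLength.exists_curve [Fact G.Connected] {p q : MetricGraph G} {L : ℝ}
    (hL : IsPathLength G p q L) : ∃ γ : ℝ → MetricGraph G, IsArcLengthCurve γ L p q := by
  induction hL with
  | nil p => exact ⟨_, IsArcLengthCurve.refl p⟩
  | @cons v w h s t hs ht r L _ ih =>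
    have edge : ∀ {s t : ℝ} (hs : s ∈ Set.Icc (0 : ℝ) 1) (ht : t ∈ Set.Icc (0 : ℝ) 1), s ≤ t →
        ∃ γ : ℝ → MetricGraph G, IsArcLengthCurve γ (t - s) (onEdge h s hs) (onEdge h t ht) := by
      intro s t hs ht hst
      let γ : ℝ → MetricGraph G := fun a =>
        onEdge h (Set.projIcc 0 1 zero_le_one (s + a)) (Subtype.coe_prop _)
      have hγ : ∀ a (ha : s + a ∈ Set.Icc (0 : ℝ) 1), γ a = onEdge h (s + a) ha := fun a ha =>
        onEdge_congr _ _ _ (by rw [Set.projIcc_of_mem zero_le_one ha])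
      have hmem : ∀ a ∈ Set.Icc 0 (t - s), s + a ∈ Set.Icc (0 : ℝ) 1 := fun a ha =>
        ⟨by linarith [ha.1, hs.1], by linarith [ha.2, ht.2]⟩
      have hc : IsArcLengthCurve γ (t - s) (γ 0) (γ (t - s)) := by
        refine IsArcLengthCurve.of_isometry (sub_nonneg.2 hst) fun a ha b hb => ?_
        rw [hγ a (hmem a ha), hγ b (hmem b hb), dist_onEdge, add_sub_add_left_eq_sub]
      have h0 : γ 0 = onEdge h s hs :=
        (hγ 0 (by simpa using hs)).trans (onEdge_congr _ _ _ (add_zero s))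
      have h1 : γ (t - s) = onEdge h t ht :=
        (hγ (t - s) (by simpa using ht)).trans (onEdge_congr _ _ _ (add_sub_cancel s t))
      rw [h0, h1] at hc
      exact ⟨γ, hc⟩
    obtain ⟨γ₂, h₂⟩ := ih
    have h₁ : ∃ γ : ℝ → MetricGraph G,
        IsArcLengthCurve γ |s - t| (onEdge h s hs) (onEdge h t ht) := by
      rcases le_total s t with hst | hst
      · rw [abs_sub_comm, abs_of_nonneg (sub_nonneg.2 hst)]
        exact edge hs ht hst
      · rw [abs_of_nonneg (sub_nonneg.2 hst)]
        obtain ⟨γ, hγ⟩ := edge ht hs hst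
        exact ⟨_, hγ.symm⟩
    obtain ⟨γ₁, h₁⟩ := h₁
    exact ⟨_, h₁.trans h₂⟩

variable [Fact G.Connected]

theorem exists_isPathLength_lt {p q : MetricGraph G} {r : ℝ} (h : dist p q < r) :
    ∃ L, IsPathLength G p q L ∧ L < r :=
  exists_lt_of_csInf_lt (exists_isPathLength p q) h

theorem isLengthMetric : IsLengthMetric (MetricGraph G) := by
  intro p q r h
  obtain ⟨L, hL, hLr⟩ := exists_isPathLength_lt h
  obtain ⟨γ, hγ⟩ := hL.exists_curve
  exact ⟨L, γ, hγ, hLr⟩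

theorem abs_apply_sub_le_dist (p q : MetricGraph G) (u : V) : |p.1 u - q.1 u| ≤ dist p q :=
  le_dist fun _ h => h.abs_sub_le u

theorem dist_vertex_le {p : MetricGraph G} {v : V} (hp : 0 < p.1 v) :
    dist p (vertex G v) ≤ 1 - p.1 v := by
  rcases eq_vertex_or_onEdge_of_pos hp with rfl | ⟨w, h, t, ht, rfl⟩
  · rw [dist_self]
    simp [vertex]
  · rw [onEdge_apply_left, ← onEdge_zero h, dist_onEdge]
    simp [abs_of_nonneg ht.1]

open Filter Topology in
-- No local finiteness is required. The tail of a Cauchy sequence stays in the star of one vertex v,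
-- and its coordinate at v converges to some c. If c = 1 the limit is v; otherwise the tail keeps
-- away from v, cannot change edges, and converges inside a single edge.
instance : CompleteSpace (MetricGraph G) := by
  refine Metric.complete_of_cauchySeq_tendsto fun u hu => ?_
  rw [Metric.cauchySeq_iff] at hu
  obtain ⟨N, hN⟩ := hu (1 / 4) (by norm_num)
  obtain ⟨v, hv⟩ := exists_half_le (u N)
  have hpos : ∀ n ≥ N, 1 / 4 < (u n).1 v := by
    intro n hn
    have h1 := (abs_apply_sub_le_dist (u N) (u n) v).trans_lt (hN N le_rfl n hn)
    linarith [(abs_lt.1 h1).2]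
  have hc : CauchySeq fun n => (u n).1 v := by
    rw [Metric.cauchySeq_iff]
    intro δ hδ
    obtain ⟨M, hM⟩ := hu δ hδ
    exact ⟨M, fun m hm n hn => (abs_apply_sub_le_dist _ _ v).trans_lt (hM m hm n hn)⟩
  obtain ⟨c, hc⟩ := cauchySeq_tendsto_of_complete hc
  have hle : ∀ n ≥ N, dist (u n) (vertex G v) ≤ 1 - (u n).1 v := fun n hn =>
    dist_vertex_le (by linarith [hpos n hn])
  have hc1 : c ≤ 1 := by
    refine le_of_tendsto hc ?_
    filter_upwards [eventually_ge_atTop N] with n hn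
    linarith [hle n hn, dist_nonneg (x := u n) (y := vertex G v)]
  have hc0 : 0 ≤ c := by
    refine ge_of_tendsto hc ?_
    filter_upwards [eventually_ge_atTop N] with n hn
    linarith [hpos n hn]
  rcases hc1.eq_or_lt with rfl | hc1
  · refine ⟨vertex G v, tendsto_iff_dist_tendsto_zero.2 ?_⟩
    refine squeeze_zero' (Eventually.of_forall fun _ => dist_nonneg)
      ((eventually_ge_atTop N).mono hle) ?_
    simpa using (tendsto_const_nhds (x := (1 : ℝ))).sub hc
  · have hfar : ∀ᶠ n in atTop, (1 - c) / 2 < 1 - (u n).1 v :=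
      (tendsto_const_nhds.sub hc).eventually (lt_mem_nhds (by linarith))
    obtain ⟨M₁, hM₁⟩ := eventually_atTop.1 hfar
    obtain ⟨M₂, hM₂⟩ := hu ((1 - c) / 2) (by linarith)
    set M := max N (max M₁ M₂) with hM
    have hMN : N ≤ M := le_max_left _ _
    have hMM₁ : M₁ ≤ M := (le_max_left _ _).trans (le_max_right _ _)
    have hMM₂ : M₂ ≤ M := (le_max_right _ _).trans (le_max_right _ _)
    obtain ⟨w, h, t, ht, hMt⟩ : ∃ (w : V) (h : G.Adj v w) (t : ℝ) (ht : t ∈ Set.Icc (0 : ℝ) 1),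
        u M = onEdge h t ht := by
      rcases eq_vertex_or_onEdge_of_pos (p := u M) (v := v)
        (by linarith [hpos M hMN]) with e | e
      · have := hM₁ M hMM₁
        simp only [e, vertex, Finsupp.single_eq_same] at this
        linarith
      · exact e
    have hform : ∀ n ≥ M, ∃ ht : 1 - (u n).1 v ∈ Set.Icc (0 : ℝ) 1, u n = onEdge h _ ht := by
      intro n hn
      -- The coordinate of `u M` at w exceeds (1 - c)/2 and the tail moves by less than that, so w
      -- remains an endpoint of the edge.
      have hw : 0 < (u n).1 w := by
        have h1 := (abs_apply_sub_le_dist (u M) (u n) w).trans_lt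
          (hM₂ M hMM₂ n (hMM₂.trans hn))
        have h2 := hM₁ M hMM₁
        have h3 : (u M).1 w = 1 - (u M).1 v := by
          rw [hMt, onEdge_apply_left]
          simp [onEdge, edgePoint, h.ne]
        linarith [(abs_lt.1 h1).2]
      rcases eq_vertex_or_onEdge_of_pos (p := u n) (v := v)
        (by linarith [hpos n (hMN.trans hn)]) with e | ⟨w', h', s, hs, e⟩
      · rw [e] at hw
        simp [vertex, h.ne] at hw
      · obtain rfl : w' = w := by
          by_contra hne
          rw [e, onEdge_apply_of_ne h' hs h.ne hne] at hw
          exact lt_irrefl _ hw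
        have h4 : 1 - (u n).1 v = s := by
          rw [e, onEdge_apply_left, sub_sub_cancel]
        exact ⟨h4 ▸ hs, e.trans (onEdge_congr _ _ _ h4.symm)⟩
    refine ⟨onEdge h (1 - c) ⟨by linarith, by linarith⟩, tendsto_iff_dist_tendsto_zero.2 ?_⟩
    have hlim : Tendsto (fun n => |(1 - (u n).1 v) - (1 - c)|) atTop (𝓝 0) := by
      simpa using ((tendsto_const_nhds (x := (1 : ℝ)).sub hc).sub_const (1 - c)).abs
    refine hlim.congr' ?_
    filter_upwards [eventually_ge_atTop M] with n hn
    obtain ⟨hs, e⟩ := hform n hn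
    exact ((congrArg (fun p => dist p _) e).trans (dist_onEdge h _ _)).symm

/-- The extension of a function on the vertices which is affine on each edge. -/
noncomputable def affineExtension (φ : V → ℝ) (p : MetricGraph G) : ℝ :=
  Finsupp.linearCombination ℝ φ p.1

omit [Fact G.Connected] in
theorem affineExtension_vertex (φ : V → ℝ) (v : V) : affineExtension φ (vertex G v) = φ v := by
  simp [affineExtension, vertex]

omit [Fact G.Connected] in
theorem affineExtension_onEdge (φ : V → ℝ) {v w : V} (h : G.Adj v w) {t : ℝ}
    (ht : t ∈ Set.Icc (0 : ℝ) 1) :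
    affineExtension φ (onEdge h t ht) = (1 - t) * φ v + t * φ w := by
  simp only [affineExtension, onEdge, edgePoint, map_add, Finsupp.linearCombination_single,
    smul_eq_mul]

/-- The increments along the linear pieces are added up; the factor exp(εL) pays for moving the
density back to the starting point at each step of the induction. -/
theorem IsPathLength.abs_affineExtension_sub_le {ε K : ℝ} (hε : 0 ≤ ε) (hK : 0 ≤ K)
    {x₀ : MetricGraph G} {φ : V → ℝ}
    (hφ : ∀ (v w : V) (h : G.Adj v w) (t : ℝ) (ht : t ∈ Set.Icc (0 : ℝ) 1),
      |φ v - φ w| ≤ K * density ε x₀ (onEdge h t ht)) {p q : MetricGraph G} {L : ℝ}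
    (hL : IsPathLength G p q L) :
    |affineExtension φ p - affineExtension φ q|
      ≤ K * L * Real.exp (ε * L) * density ε x₀ p := by
  induction hL with
  | nil p => simp
  | @cons v w h s t hs ht r L hL ih =>
    have hL0 := hL.nonneg
    have h1 : |affineExtension φ (onEdge h s hs) - affineExtension φ (onEdge h t ht)|
        ≤ |s - t| * (K * density ε x₀ (onEdge h s hs)) := by
      rw [affineExtension_onEdge, affineExtension_onEdge,
        show (1 - s) * φ v + s * φ w - ((1 - t) * φ v + t * φ w) = -((s - t) * (φ v - φ w)) by ring,
        abs_neg, abs_mul]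
      exact mul_le_mul_of_nonneg_left (hφ v w h s hs) (abs_nonneg _)
    have h2 : density ε x₀ (onEdge h t ht)
        ≤ Real.exp (ε * |s - t|) * density ε x₀ (onEdge h s hs) :=
      density_le hε (by rw [dist_onEdge, abs_sub_comm])
    set ρ := density ε x₀ (onEdge h s hs)
    have hρ : 0 < ρ := density_pos _
    have h3 : K * L * Real.exp (ε * L) * density ε x₀ (onEdge h t ht)
        ≤ K * L * Real.exp (ε * (|s - t| + L)) * ρ := by
      refine (mul_le_mul_of_nonneg_left h2 (by positivity)).trans_eq ?_
      rw [mul_add, Real.exp_add]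
      ring
    have h4 : |s - t| * (K * ρ) ≤ K * |s - t| * Real.exp (ε * (|s - t| + L)) * ρ := by
      have : 1 ≤ Real.exp (ε * (|s - t| + L)) := Real.one_le_exp (by positivity)
      calc |s - t| * (K * ρ) = K * |s - t| * 1 * ρ := by ring
        _ ≤ _ := by gcongr
    refine (_root_.abs_sub_le _ _ _).trans ((add_le_add (h1.trans h4) (ih.trans h3)).trans_eq ?_)
    ring

theorem abs_affineExtension_sub_le {ε K : ℝ} (hε : 0 ≤ ε) (hK : 0 ≤ K)
    {x₀ : MetricGraph G} {φ : V → ℝ}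
    (hφ : ∀ (v w : V) (h : G.Adj v w) (t : ℝ) (ht : t ∈ Set.Icc (0 : ℝ) 1),
      |φ v - φ w| ≤ K * density ε x₀ (onEdge h t ht)) {p q : MetricGraph G} (hpq : dist p q ≤ 1) :
    |affineExtension φ p - affineExtension φ q|
      ≤ K * (2 * Real.exp (2 * ε)) * density ε x₀ p * dist p q := by
  rcases eq_or_ne p q with rfl | hne
  · simp
  have hd : 0 < dist p q := dist_pos.2 hne
  obtain ⟨L, hL, hL'⟩ := exists_isPathLength_lt (r := 2 * dist p q) (by linarith)
  refine (hL.abs_affineExtension_sub_le hε hK hφ).trans ?_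
  have hρ : 0 < density ε x₀ p := density_pos _
  have h1 : Real.exp (ε * L) ≤ Real.exp (2 * ε) := Real.exp_le_exp.2 (by nlinarith)
  calc K * L * Real.exp (ε * L) * density ε x₀ p
      ≤ K * (2 * dist p q) * Real.exp (2 * ε) * density ε x₀ p := by gcongr
    _ = _ := by ring

omit [Fact G.Connected] in
theorem exists_vertex_dist_le_one (p : MetricGraph G) :
    ∃ (v : V) (L : ℝ), IsPathLength G p (vertex G v) L ∧ L ≤ 1 := by
  obtain ⟨v, hv⟩ := exists_half_le p
  rcases eq_vertex_or_onEdge_of_pos (p := p) (v := v) (by linarith) with rfl | ⟨w, h, t, ht, rfl⟩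
  · exact ⟨v, 0, .nil _, zero_le_one⟩
  · refine ⟨v, |t - 0|, ?_, ?_⟩
    · rw [← onEdge_zero h]
      exact .edge h ht _
    · rw [sub_zero, abs_of_nonneg ht.1]
      exact ht.2

omit [Fact G.Connected] in
theorem isPathLength_of_adj {v w : V} (h : G.Adj v w) :
    IsPathLength G (vertex G v) (vertex G w) 1 := by
  rw [← onEdge_zero h, ← onEdge_one h]
  convert IsPathLength.edge h _ _
  simp

end MetricGraph

/-! ### Hyperbolic fillings: ancestors, snowflaked distances, branching points -/

namespace HyperbolicFilling

open MetricGraph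

variable {Z : Type*} [MetricSpace Z] {α τ : ℝ}

theorem alpha_pos (H : HyperbolicFilling Z α τ) : 0 < α := zero_lt_one.trans H.one_lt_alpha

/-- At every level a net point close to the same x is chosen. Consecutive choices are neighbors
because both balls contain x, and no error accumulates. -/
theorem exists_isPathLength_ancestor (H : HyperbolicFilling Z α τ) {k n : ℕ} (hkn : k ≤ n) (x : Z) {p : Z} (hp : p ∈ H.A n)
    (hxp : dist x p < (α ^ n)⁻¹) :
    ∃ (q : Z) (hq : q ∈ H.A k), dist x q < (α ^ k)⁻¹ ∧
      IsPathLength H.graph (vertex H.graph ⟨p, n, hp⟩) (vertex H.graph ⟨q, k, hq⟩) (n - k) := by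
  induction n, hkn using Nat.le_induction generalizing p with
  | base => exact ⟨p, hp, hxp, by simpa using IsPathLength.nil _⟩
  | succ n hkn ih =>
    obtain ⟨p', hp', hxp'⟩ := H.exists_mem_dist_lt n x
    obtain ⟨q, hq, hxq, hL⟩ := ih hp' hxp'
    refine ⟨q, hq, hxq, ?_⟩
    have hadj : H.graph.Adj ⟨p, n + 1, hp⟩ ⟨p', n, hp'⟩ := by
      change H.IsNeighbor _ _
      refine ⟨fun h => ?_, Or.inr ⟨Or.inl rfl, x, hxp, hxp'⟩⟩
      simpa using congrArg Vertex.level h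
    have := (isPathLength_of_adj hadj).trans hL
    rwa [show (1 : ℝ) + (n - k) = ((n + 1 : ℕ) : ℝ) - k by push_cast; ring] at this

theorem abs_level_sub_le (H : HyperbolicFilling Z α τ) {v w : H.Vertex} (h : H.graph.Adj v w) :
    |(v.level : ℝ) - w.level| ≤ 1 := by
  obtain ⟨-, ⟨h, -⟩ | ⟨h | h, -⟩⟩ := h
  · simp [h]
  · simp [h]
  · simp [h]

/-- A chain of ancestors reaches the root in as many steps as the level. Conversely, the level
changes by at most one across an edge; the affine estimate at ε = 0, where the density is 1, turns
this into a Lipschitz bound. -/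
theorem dist_vertex_root (H : HyperbolicFilling Z α τ) (v : H.Vertex) : dist (vertex H.graph v) H.root = v.level := by
  apply le_antisymm
  · obtain ⟨q, hq, -, hL⟩ := H.exists_isPathLength_ancestor v.level.zero_le v.point v.mem (by
      rw [dist_self]
      have := H.alpha_pos
      positivity)
    obtain rfl : q = H.z₀ := by simpa [H.A_zero] using hq
    simpa using! hL.dist_le
  · refine le_dist fun L hL => ?_
    have := hL.abs_affineExtension_sub_le (ε := 0) (x₀ := H.root) le_rfl zero_le_one
      (φ := fun v => (v.level : ℝ)) fun v w h t ht => by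
        simpa [density] using H.abs_level_sub_le h
    rw [root, affineExtension_vertex, affineExtension_vertex] at this
    simpa [density, rootVertex] using this

theorem density_vertex (H : HyperbolicFilling Z α τ) (ε : ℝ) (v : H.Vertex) :
    density ε H.root (vertex H.graph v) = Real.exp (-ε * v.level) := by
  rw [density, dist_vertex_root]

/-- Relative to the scale of v, the cases of w at the same level, one level lower and one level
higher give 2τ, 1 + α and 1 + α⁻¹; the stated factor covers all three. -/
theorem dist_point_le (H : HyperbolicFilling Z α τ) {v w : H.Vertex} (h : H.graph.Adj v w) :
    dist v.point w.point ≤ 2 * τ * α * (α ^ v.level)⁻¹ := by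
  have hα := H.one_lt_alpha
  have hτ := H.one_lt_tau
  have hα0 := H.alpha_pos
  have hpos : ∀ n : ℕ, 0 < (α ^ n)⁻¹ := fun n => by positivity
  have hsucc : ∀ n : ℕ, (α ^ n)⁻¹ = α * (α ^ (n + 1))⁻¹ := fun n => by
    rw [pow_succ]
    field_simp
  obtain ⟨-, ⟨h, z, hv, hw⟩ | ⟨h | h, z, hv, hw⟩⟩ := h <;>
    rw [Metric.mem_ball, dist_comm] at hv <;> rw [Metric.mem_ball] at hw <;> rw [h] at *
  · have h1 := hpos w.level
    have h2 : τ * (α ^ w.level)⁻¹ ≤ τ * α * (α ^ w.level)⁻¹ := by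
      refine mul_le_mul_of_nonneg_right ?_ h1.le
      nlinarith
    linarith [dist_triangle v.point z w.point]
  · have h1 := hpos (w.level + 1)
    rw [hsucc w.level] at hw
    have h2 : (1 + α) * (α ^ (w.level + 1))⁻¹ ≤ 2 * τ * α * (α ^ (w.level + 1))⁻¹ := by
      refine mul_le_mul_of_nonneg_right ?_ h1.le
      nlinarith
    linarith [dist_triangle v.point z w.point]
  · have h1 := hpos (v.level + 1)
    rw [hsucc v.level] at hv ⊢
    have h2 : (α + 1) * (α ^ (v.level + 1))⁻¹ ≤ 2 * τ * α * (α * (α ^ (v.level + 1))⁻¹) := by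
      rw [← mul_assoc]
      refine mul_le_mul_of_nonneg_right ?_ h1.le
      nlinarith [mul_pos hα0 hα0, mul_pos hα0 (sub_pos.2 hα), mul_pos (mul_pos hα0 hα0) (sub_pos.2 hτ)]
    linarith [dist_triangle v.point z w.point]

variable {ε : ℝ}

/-- The exponent ε / log α is the one that converts the scale of level n in Z into the density at
that level. -/
theorem inv_pow_rpow (H : HyperbolicFilling Z α τ) (n : ℕ) :
    ((α ^ n)⁻¹) ^ (ε / Real.log α) = Real.exp (-ε * n) := by
  have hα := H.alpha_pos
  have hlog : 0 < Real.log α := Real.log_pos H.one_lt_alpha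
  rw [Real.rpow_def_of_pos (by positivity), Real.log_inv, Real.log_pow]
  congr 1
  field_simp

theorem exp_level_le_density (H : HyperbolicFilling Z α τ) (hε : 0 ≤ ε) {v w : H.Vertex} (h : H.graph.Adj v w) {t : ℝ}
    (ht : t ∈ Set.Icc (0 : ℝ) 1) :
    Real.exp (-ε * v.level) ≤ Real.exp ε * density ε H.root (onEdge h t ht) := by
  rw [← H.density_vertex]
  have := density_le (x₀ := H.root) (p := vertex H.graph v) (q := onEdge h t ht) (r := 1) hε (by
    rw [← onEdge_zero h, dist_onEdge, zero_sub, abs_neg, abs_of_nonneg ht.1]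
    exact ht.2)
  simpa using this

/-- The condition ε ≤ log α enters here: it makes the exponent at most 1, so the power is
subadditive and the triangle inequality survives. -/
theorem abs_rpow_sub_le (H : HyperbolicFilling Z α τ) (hε : 0 ≤ ε) (hεα : ε ≤ Real.log α) (x : Z) {v w : H.Vertex}
    (h : H.graph.Adj v w) :
    |dist v.point x ^ (ε / Real.log α) - dist w.point x ^ (ε / Real.log α)|
      ≤ (2 * τ * α) ^ (ε / Real.log α) * Real.exp (-ε * v.level) := by
  have hα := H.alpha_pos
  have hτ : 0 < τ := zero_lt_one.trans H.one_lt_tau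
  have hlog : 0 < Real.log α := Real.log_pos H.one_lt_alpha
  have hσ0 : 0 ≤ ε / Real.log α := by positivity
  have hσ1 : ε / Real.log α ≤ 1 := by rwa [div_le_one hlog]
  rw [← H.inv_pow_rpow, ← Real.mul_rpow (by positivity) (by positivity)]
  have hd := H.dist_point_le h
  have key : ∀ a b : Z, dist a b ≤ 2 * τ * α * (α ^ v.level)⁻¹ →
      dist a x ^ (ε / Real.log α) - dist b x ^ (ε / Real.log α)
        ≤ (2 * τ * α * (α ^ v.level)⁻¹) ^ (ε / Real.log α) := by
    intro a b hab
    rw [sub_le_iff_le_add]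
    refine le_trans (Real.rpow_le_rpow dist_nonneg ?_ hσ0)
      (Real.rpow_add_le_add_rpow (by positivity) dist_nonneg hσ0 hσ1)
    linarith [dist_triangle a b x]
  exact abs_sub_le_iff.2 ⟨key _ _ hd, key _ _ (by rwa [dist_comm])⟩

/-- The test function is the affine extension of the snowflaked distance to the point of v. Its
increment from x to y contributes e^ε in the last factor; passing from x to v and from y to w
contributes e^(3ε) each, since ρ(x) and ρ(y) are at most e^(3ε) d_ε(x,y). -/
theorem rpow_dist_le_uniformizedDist (H : HyperbolicFilling Z α τ) (hε : 0 ≤ ε) (hεα : ε ≤ Real.log α) {x y : H.Space}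
    (hxy : 1 ≤ dist x y) {v w : H.Vertex} (hv : dist x (vertex H.graph v) ≤ 1)
    (hw : dist y (vertex H.graph w) ≤ 1) :
    dist w.point v.point ^ (ε / Real.log α)
      ≤ (2 * τ * α) ^ (ε / Real.log α) * Real.exp ε * (2 * Real.exp (2 * ε))
        * (Real.exp ε + 2 * Real.exp (3 * ε)) * uniformizedDist ε H.root x y := by
  -- For ε = 0 the test function would not vanish at v, because 0 ^ 0 = 1.
  rcases hε.eq_or_lt with rfl | hε0
  · have h1 := density_mul_min_le_uniformizedDist (ε := 0) (x₀ := H.root) le_rfl x y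
    rw [min_eq_right hxy] at h1
    norm_num [density] at h1 ⊢
    linarith
  have hα := H.alpha_pos
  have hτ : 0 < τ := zero_lt_one.trans H.one_lt_tau
  have hlog : 0 < Real.log α := Real.log_pos H.one_lt_alpha
  set σ := ε / Real.log α with hσ
  set K := (2 * τ * α) ^ σ * Real.exp ε with hK
  have hKpos : 0 < K := by positivity
  set φ : H.Vertex → ℝ := fun u => dist u.point v.point ^ σ with hφ
  have hedge : ∀ (a b : H.Vertex) (h : H.graph.Adj a b) (t : ℝ) (ht : t ∈ Set.Icc (0 : ℝ) 1),
      |φ a - φ b| ≤ K * density ε H.root (onEdge h t ht) := by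
    intro a b h t ht
    refine (H.abs_rpow_sub_le hε hεα v.point h).trans ?_
    rw [hK, mul_assoc _ (Real.exp ε)]
    exact mul_le_mul_of_nonneg_left (H.exp_level_le_density hε h ht) (by positivity)
  have hlip : ∀ p q : H.Space, dist p q ≤ 1 →
      |affineExtension φ p - affineExtension φ q|
        ≤ K * (2 * Real.exp (2 * ε)) * density ε H.root p * dist p q := fun p q hpq =>
    abs_affineExtension_sub_le hε hKpos.le hedge hpq
  have hvertex : ∀ (p q : H.Space) (u : H.Vertex), 1 ≤ dist p q → dist p (vertex H.graph u) ≤ 1 →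
      |affineExtension φ p - φ u|
        ≤ K * (2 * Real.exp (2 * ε)) * (Real.exp (3 * ε) * uniformizedDist ε H.root p q) := by
    intro p q u hpq hu
    have h1 := density_mul_min_le_uniformizedDist (x₀ := H.root) hε p q
    rw [min_eq_right hpq, mul_one] at h1
    have h2 := hlip p (vertex H.graph u) hu
    rw [affineExtension_vertex] at h2
    have hρ : 0 < density ε H.root p := density_pos p
    refine h2.trans ((mul_le_of_le_one_right (by positivity) hu).trans ?_)
    exact mul_le_mul_of_nonneg_left h1 (by positivity)
  have h1 := hvertex x y v hxy hv
  have h2 := hvertex y x w (by rwa [dist_comm]) hw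
  rw [uniformizedDist_comm] at h2
  have h3 := abs_sub_le_uniformizedDist hε (by positivity) hlip x y
  have hv0 : φ v = 0 := by
    simp only [hφ, dist_self]
    exact Real.zero_rpow (by positivity)
  rw [hv0] at h1
  have h4 : φ w ≤ |affineExtension φ x - 0| + |affineExtension φ x - affineExtension φ y|
      + |affineExtension φ y - φ w| := by
    linarith [(abs_le.1 (le_refl |affineExtension φ x - 0|)).2,
      (abs_le.1 (le_refl |affineExtension φ x - affineExtension φ y|)).1,
      (abs_le.1 (le_refl |affineExtension φ y - φ w|)).1]
  change φ w ≤ _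
  linarith

/-- The enlargement of horizontal balls by τ > 1 is made for this: if x and y are within (τ - 1)α⁻ᵏ,
then y lies in both enlarged balls. At level 0 there is only the root. -/
theorem exists_isPathLength_same_level (H : HyperbolicFilling Z α τ) {k : ℕ} {x y p q : Z} (hp : p ∈ H.A k) (hq : q ∈ H.A k)
    (hxp : dist x p < (α ^ k)⁻¹) (hyq : dist y q < (α ^ k)⁻¹)
    (hk : k = 0 ∨ dist x y ≤ (τ - 1) * (α ^ k)⁻¹) :
    ∃ L ≤ 1, IsPathLength H.graph (vertex H.graph ⟨p, k, hp⟩) (vertex H.graph ⟨q, k, hq⟩) L := by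
  have hα := H.alpha_pos
  by_cases hpq : p = q
  · subst hpq
    exact ⟨0, zero_le_one, .nil _⟩
  rcases hk with rfl | hk
  · rw [H.A_zero] at hp hq
    exact absurd (hp.trans hq.symm) hpq
  refine ⟨1, le_rfl, isPathLength_of_adj ?_⟩
  change H.IsNeighbor _ _
  refine ⟨fun h => hpq (congrArg Vertex.point h), Or.inl ⟨rfl, y, ?_, ?_⟩⟩
  · rw [Metric.mem_ball]
    simp only
    linarith [dist_triangle y x p, dist_comm x y]
  · rw [Metric.mem_ball]
    have : 0 < (α ^ k)⁻¹ := by positivity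
    simp only
    nlinarith [H.one_lt_tau]

/-- The greatest admissible k is taken; if k < n, failure at k + 1 gives the reverse inequality at
the cost of a factor α. Admitting k = 0 unconditionally guarantees that a greatest one exists. -/
theorem exists_branching_level (H : HyperbolicFilling Z α τ) (x y : Z) (n : ℕ) :
    ∃ k ≤ n, (k = 0 ∨ dist x y ≤ (τ - 1) * (α ^ k)⁻¹) ∧
      (k = n ∨ (α ^ k)⁻¹ ≤ α / (τ - 1) * dist x y) := by
  classical
  have hα := H.alpha_pos
  have hτ : 0 < τ - 1 := sub_pos.2 H.one_lt_tau
  let P : ℕ → Prop := fun k => k = 0 ∨ dist x y ≤ (τ - 1) * (α ^ k)⁻¹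
  refine ⟨Nat.findGreatest P n, Nat.findGreatest_le n,
    Nat.findGreatest_spec (P := P) n.zero_le (Or.inl rfl), ?_⟩
  refine (Nat.findGreatest_le (P := P) n).eq_or_lt.imp id fun hlt => ?_
  have h1 := Nat.findGreatest_is_greatest (Nat.lt_succ_self (Nat.findGreatest P n)) hlt
  have h2 : ¬ dist x y ≤ (τ - 1) * (α ^ (Nat.findGreatest P n + 1))⁻¹ := fun h => h1 (Or.inr h)
  rw [not_le, pow_succ, mul_inv] at h2
  rw [div_mul_eq_mul_div, le_div_iff₀ hτ]
  calc (α ^ Nat.findGreatest P n)⁻¹ * (τ - 1)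
      = α * ((τ - 1) * ((α ^ Nat.findGreatest P n)⁻¹ * α⁻¹)) := by field_simp
    _ ≤ α * dist x y := mul_le_mul_of_nonneg_left h2.le hα.le

/-- The constant bounding `ρ_ε` at the branching point of two points `x, y` of the hyperbolic
filling in terms of `d_ε(x, y)`. -/
noncomputable def branchingConst (α τ ε : ℝ) : ℝ :=
  max (Real.exp (4 * ε)) ((α / (τ - 1)) ^ (ε / Real.log α) *
    ((2 * τ * α) ^ (ε / Real.log α) * Real.exp ε * (2 * Real.exp (2 * ε))
        * (Real.exp ε + 2 * Real.exp (3 * ε))))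

theorem exists_branching_point (H : HyperbolicFilling Z α τ) (hε : 0 ≤ ε) (hεα : ε ≤ Real.log α) (x y : H.Space)
    (hxy : 1 ≤ dist x y) : ∃ u : H.Space,
      (∃ (N : ℝ) (γ : ℝ → H.Space), IsArcLengthCurve γ N x u ∧
        N ≤ dist x H.root - dist u H.root + 3) ∧
      (∃ (N : ℝ) (γ : ℝ → H.Space), IsArcLengthCurve γ N y u ∧
        N ≤ dist y H.root - dist u H.root + 3) ∧
      density ε H.root u ≤ branchingConst α τ ε * uniformizedDist ε H.root x y := by
  have hα := H.alpha_pos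
  have hτ : 0 < τ - 1 := sub_pos.2 H.one_lt_tau
  have hlog : 0 < Real.log α := Real.log_pos H.one_lt_alpha
  have hdnn : 0 ≤ uniformizedDist ε H.root x y :=
    dist_nonneg (α := Uniformization H.Space H.root ε)
  obtain ⟨⟨a, n, ha⟩, L₁, hL₁, hL₁'⟩ := exists_vertex_dist_le_one x
  obtain ⟨⟨b, m, hb⟩, L₂, hL₂, hL₂'⟩ := exists_vertex_dist_le_one y
  obtain ⟨k, hkn, hk, hk'⟩ := H.exists_branching_level a b (min n m)
  obtain ⟨p, hp, hap, hP⟩ := H.exists_isPathLength_ancestor (hkn.trans (min_le_left _ _)) a ha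
    (by rw [dist_self]; positivity)
  obtain ⟨q, hq, hbq, hQ⟩ := H.exists_isPathLength_ancestor (hkn.trans (min_le_right _ _)) b hb
    (by rw [dist_self]; positivity)
  obtain ⟨L₃, hL₃', hL₃⟩ := H.exists_isPathLength_same_level hp hq hap hbq hk
  obtain ⟨γ₁, h₁⟩ := ((hL₁.trans hP).trans hL₃).exists_curve
  obtain ⟨γ₂, h₂⟩ := (hL₂.trans hQ).exists_curve
  have d₁ := hL₁.dist_le
  have d₂ := hL₂.dist_le
  have e₁ := H.dist_vertex_root ⟨a, n, ha⟩
  have e₂ := H.dist_vertex_root ⟨b, m, hb⟩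
  have e₃ := H.dist_vertex_root ⟨q, k, hq⟩
  simp only at e₁ e₂ e₃
  -- The branching point is the ancestor on the side of y. For x the excess 3 consists of the step
  -- to a vertex, the possible gain in level in that step, and the horizontal edge; for y the excess
  -- is only 2.
  refine ⟨vertex H.graph ⟨q, k, hq⟩, ⟨_, γ₁, h₁, ?_⟩, ⟨_, γ₂, h₂, ?_⟩, ?_⟩
  · linarith [dist_triangle (vertex H.graph ⟨a, n, ha⟩) x H.root,
      dist_comm x (vertex H.graph ⟨a, n, ha⟩)]
  · linarith [dist_triangle (vertex H.graph ⟨b, m, hb⟩) y H.root,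
      dist_comm y (vertex H.graph ⟨b, m, hb⟩)]
  · have hend : ∀ (p q : H.Space) (u : H.Vertex), 1 ≤ dist p q →
        dist p (vertex H.graph u) ≤ 1 → u.level = k →
        Real.exp (-ε * k) ≤ Real.exp (4 * ε) * uniformizedDist ε H.root p q := by
      intro p q u hpq hu hk
      rw [← hk, ← H.density_vertex]
      have h1 := density_mul_min_le_uniformizedDist (x₀ := H.root) hε p q
      rw [min_eq_right hpq, mul_one] at h1
      have h2 := density_le (x₀ := H.root) hε ((dist_comm _ _).trans_le hu)
      rw [mul_one] at h2
      refine h2.trans ((mul_le_mul_of_nonneg_left h1 (Real.exp_pos _).le).trans_eq ?_)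
      rw [← mul_assoc, ← Real.exp_add]
      ring_nf
    rw [H.density_vertex]
    -- Either u has the level of the vertex near x or near y, and the truncated distance bounds its
    -- density, or its scale is at most a multiple of the distance in Z, which the snowflake
    -- estimate handles.
    rcases hk' with hk' | hk'
    · refine le_trans ?_ (mul_le_mul_of_nonneg_right (le_max_left _ _) hdnn)
      rcases min_choice n m with hnm | hnm
      · exact hend x y _ hxy (d₁.trans hL₁') (hnm ▸ hk').symm
      · rw [uniformizedDist_comm]
        exact hend y x _ (by rwa [dist_comm]) (d₂.trans hL₂') (hnm ▸ hk').symm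
    · refine le_trans ?_ (mul_le_mul_of_nonneg_right (le_max_right _ _) hdnn)
      have h1 := H.rpow_dist_le_uniformizedDist hε hεα hxy (d₁.trans hL₁') (d₂.trans hL₂')
      rw [← H.inv_pow_rpow]
      refine (Real.rpow_le_rpow (by positivity) hk' (by positivity)).trans ?_
      rw [Real.mul_rpow (by positivity) dist_nonneg, mul_assoc]
      rw [dist_comm] at h1
      exact mul_le_mul_of_nonneg_left h1 (by positivity)

/-- The vertical ray over z₀ is Cauchy, with geometrically decreasing steps. It leaves the unit ball
of d about each p, hence eventually stays at d_ε-distance at least e^(-3ε) ρ(p) from p. -/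
theorem not_completeSpace_uniformization (H : HyperbolicFilling Z α τ) (hε : 0 < ε) :
    ¬ CompleteSpace (Uniformization H.Space H.root ε) := by
  intro hcomplete
  have hα := H.alpha_pos
  have hz : ∀ n, H.z₀ ∈ H.A n := fun n => H.A_mono n.zero_le (by simp [H.A_zero])
  let v : ℕ → H.Space := fun n => vertex H.graph ⟨H.z₀, n, hz n⟩
  have hadj : ∀ n, H.graph.Adj ⟨H.z₀, n, hz n⟩ ⟨H.z₀, n + 1, hz (n + 1)⟩ := by
    intro n
    change H.IsNeighbor _ _
    refine ⟨fun h => ?_, Or.inr ⟨Or.inr rfl, H.z₀, ?_, ?_⟩⟩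
    · simpa using congrArg Vertex.level h
    · exact Metric.mem_ball_self (by positivity)
    · exact Metric.mem_ball_self (by positivity)
  have hstep : ∀ n, uniformizedDist ε H.root (v n) (v (n + 1))
      ≤ Real.exp ε * Real.exp (-ε) ^ n := by
    intro n
    obtain ⟨γ, h⟩ := (isPathLength_of_adj (hadj n)).exists_curve
    refine ((uniformizedDist_le h).trans (weightedLength_le hε.le h)).trans_eq ?_
    rw [H.density_vertex, ← Real.exp_nat_mul, one_mul, mul_one, mul_comm (-ε)]
  have hcauchy : CauchySeq fun n => toUniformization H.root ε (v n) :=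
    cauchySeq_of_le_geometric _ _ (Real.exp_lt_one_iff.2 (neg_lt_zero.2 hε)) hstep
  obtain ⟨p, hp⟩ := cauchySeq_tendsto_of_complete hcauchy
  obtain ⟨p, rfl⟩ : ∃ p' : H.Space, toUniformization H.root ε p' = p := ⟨p, rfl⟩
  have hlim : Filter.Tendsto (fun n => Real.exp (3 * ε) * uniformizedDist ε H.root p (v n))
      Filter.atTop (nhds 0) := by
    have := ((tendsto_const_nhds (x := toUniformization H.root ε p)).dist hp).const_mul
      (Real.exp (3 * ε))
    rwa [dist_self, mul_zero] at this
  refine (density_pos (ε := ε) (x₀ := H.root) p).not_ge (ge_of_tendsto hlim ?_)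
  obtain ⟨N, hN⟩ := exists_nat_ge (dist p H.root + 1)
  filter_upwards [Filter.eventually_ge_atTop N] with n hn
  have h1 := density_mul_min_le_uniformizedDist (x₀ := H.root) hε.le p (v n)
  have h2 : dist (v n) H.root = n := H.dist_vertex_root _
  have h3 : (N : ℝ) ≤ n := by exact_mod_cast hn
  rwa [min_eq_right (by linarith [dist_triangle (v n) p H.root, dist_comm p (v n)]), mul_one] at h1

end HyperbolicFilling

end HypFill

/-! ### Choice of the constants and conclusion -/

theorem theorem5p1 (α τ ε : ℝ) (hα : 1 < α) (hτ : 1 < τ) (hε : 0 < ε)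
    (hεα : ε ≤ Real.log α) :
    ∃ A C : ℝ, 1 ≤ A ∧ 1 ≤ C ∧
      ∀ (Z : Type*) [MetricSpace Z] (H : HypFill.HyperbolicFilling Z α τ),
        HypFill.IsUniformMetricSpace A (HypFill.Uniformization H.Space H.root ε) ∧
        ∀ x' x'' : H.Space,
          C⁻¹ * (Real.exp (-ε * HypFill.gromovProduct H.root x' x'') * min (dist x' x'') 1)
              ≤ HypFill.uniformizedDist ε H.root x' x'' ∧
          HypFill.uniformizedDist ε H.root x' x''
              ≤ C * (Real.exp (-ε * HypFill.gromovProduct H.root x' x'') * min (dist x' x'') 1) := by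
  set D := HypFill.HyperbolicFilling.branchingConst α τ ε
  -- The exponent ε * 3 reflects C₀ = 3, the excess in the descent to the branching point; B₁ bounds
  -- lengths, and B also covers the cone condition.
  set B₁ := max (2 * Real.exp (5 * ε)) (2 / ε * (Real.exp (ε * 3) * D))
  set B := max B₁ (1 / ε * Real.exp (ε * 3)) with hB
  set C₁ := max (2 * Real.exp (2 * ε)) (2 / ε * Real.exp ε)
  set C₂ := max (Real.exp (4 * ε)) (Real.exp (ε * 3) * D)
  have hB0 : 0 ≤ B := le_max_of_le_right (by positivity)
  refine ⟨max 1 (B * Real.exp (3 * ε)), max 1 (max C₁ C₂), le_max_left _ _, le_max_left _ _,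
    fun Z _ H => ⟨?_, fun x y => ⟨?_, ?_⟩⟩⟩
  · refine HypFill.isUniformMetricSpace_of_curves HypFill.MetricGraph.isLengthMetric hε.le hB0
      (le_max_left _ _) (le_max_right _ _) (H.not_completeSpace_uniformization hε) fun x y => ?_
    obtain ⟨L, γ, h, hlen, hmin⟩ := HypFill.exists_curve_of_descending
      HypFill.MetricGraph.isLengthMetric hε le_rfl (H.exists_branching_point hε.le hεα) x y
    refine ⟨L, γ, h, hlen.trans ?_, fun s hs => (hmin s hs).trans ?_⟩
    · exact mul_le_mul_of_nonneg_right (le_max_left _ _)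
        (dist_nonneg (α := HypFill.Uniformization H.Space H.root ε))
    · exact mul_le_mul_of_nonneg_right (le_max_right _ _) (HypFill.density_pos _).le
  · rw [inv_mul_le_iff₀ (zero_lt_one.trans_le (le_max_left _ _))]
    refine (HypFill.gromovProduct_le_uniformizedDist hε
      (H.exists_branching_point hε.le hεα) x y).trans ?_
    exact mul_le_mul_of_nonneg_right ((le_max_right _ _).trans (le_max_right _ _))
      (dist_nonneg (α := HypFill.Uniformization H.Space H.root ε))
  · refine (HypFill.uniformizedDist_le_gromovProduct
      HypFill.MetricGraph.isLengthMetric hε x y).trans ?_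
    exact mul_le_mul_of_nonneg_right ((le_max_left _ _).trans (le_max_right _ _)) (by positivity)
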